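/- Let $\mathbb{E}$ be a complete local principal ideal domain (that is, a field or a complete discrete valuation ring), and let $\varpi$ be a generator of its maximal ideal. Let $\mathcal{T}$ be an $\mathbb{E}$-linear triangulated category equipped with a Tate twist, i.e. an autoequivalence of triangulated categories $\langle 1\rangle:\mathcal{T}\to\mathcal{T}$, with powers $\langle k\rangle$, $k\in\mathbb{Z}$. Assume that $\mathcal{T}$ is graded $\mathrm{Hom}$-finite: for all $X,Y\in\mathcal{T}$ the $\mathbb{E}$-module $\bigoplus_{k\in\mathbb{Z}}\mathrm{Hom}(X,Y\langle k\rangle)$ is finitely generated. Let $(I,\le)$ be an ordered set isomorphic to a subset of $(\mathbb{Z}_{\ge 0},\le)$, and let $\{\nabla_i\}_{i\in I}$ be a graded exceptional sequence in $\mathcal{T}$, i.e. a family of objects such that (1) if $i<j$, then $\mathrm{Hom}(\nabla_i,\nabla_j[n]\langle k\rangle)=0$ for all $n,k\in\mathbb{Z}$; (2) $\mathrm{Hom}(\nabla_i,\nabla_i[n]\langle k\rangle)=0$ unless $n=k=0$, and $\mathrm{End}(\nabla_i)\cong\mathbb{E}$; (3) the objects $\nabla_i\langle k\rangle$ ($i\in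 I$, $k\in\mathbb{Z}$) generate $\mathcal{T}$ as a triangulated category. For $i\in I$ let $\mathcal{T}_{\le i}$ (resp. $\mathcal{T}_{<i}$) be the full triangulated subcategory generated by the $\nabla_j\langle k\rangle$ with $k\in\mathbb{Z}$ and $j\le i$ (resp. $j<i$), and let $\Pi_i:\mathcal{T}_{\le i}\to\mathcal{T}_{\le i}/\mathcal{T}_{<i}$ be the Verdier quotient functor. Assume that the sequence is dualizable, with dual sequence $\{\Delta_i\}_{i\in I}$, i.e. the $\Delta_i$ are objects such that (a) if $i<j$, then $\mathrm{Hom}(\Delta_j,\nabla_i[n]\langle k\rangle)=0$ for all $n,k\in\mathbb{Z}$; (b) for each $i\in I$, $\Delta_i\in\mathcal{T}_{\le i}$ and $\Pi_i(\Delta_i)\cong\Pi_i(\nabla_i)$. Put $\bar\nabla_i=\mathrm{cone}(\nabla_i\xrightarrow{\varpi\cdot\mathrm{id}}\nabla_i)$ if $\mathbb{E}$ is not a field, and $\bar\nabla_i=0$ if $\mathbb{E}$ is a field. Let $\mathcal{T}^{\le 0}$ be the full subcategory of $\mathcal{T}$ generated under extensions by the zero object and the objects $\Delta_j[n]\langle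 k\rangle$ with $j\in I$, $n\ge 0$, $k\in\mathbb{Z}$, and let $\mathcal{T}^{\ge 0}$ be the full subcategory generated under extensions by the zero object and the objects $\nabla_j[n]\langle k\rangle$ and $\bar\nabla_j[n]\langle k\rangle$ with $j\in I$, $n\le 0$, $k\in\mathbb{Z}$. Then $(\mathcal{T}^{\le 0},\mathcal{T}^{\ge 0})$ is a t-structure on $\mathcal{T}$. Its heart $\mathscr{A}=\mathcal{T}^{\le 0}\cap\mathcal{T}^{\ge 0}$ is a noetherian abelian category (every object satisfies the ascending chain condition on subobjects). If $\mathbb{E}$ is a field, then $\mathscr{A}$ is also artinian (every object satisfies the descending chain condition on subobjects). -/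

import Mathlib

open CategoryTheory CategoryTheory.Limits CategoryTheory.Pretriangulated

open scoped ZeroObject

universe v u w w'

namespace ExcSeq

section Generation

variable {C : Type u} [Category.{v} C] [Preadditive C] [HasZeroObject C] [HasShift C ℤ]
  [∀ n : ℤ, (shiftFunctor C n).Additive] [Pretriangulated C]

/-- The (strictly full) subcategory generated under extensions by the objects satisfying `P`:
the smallest class of objects that contains `P` and the zero objects and is closed under
extensions. Closure under isomorphisms follows, see `extClosure_of_iso`. -/
inductive extClosure (P : ObjectProperty C) : ObjectProperty C
  | of (X : C) (hX : P X) : extClosure P X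
  | zero (X : C) (hX : IsZero X) : extClosure P X
  | ext (T : Triangle C) (hT : T ∈ distTriang C) (h₁ : extClosure P T.obj₁)
      (h₃ : extClosure P T.obj₃) : extClosure P T.obj₂

/-- The (strictly full) triangulated subcategory generated by the objects satisfying `P`:
the smallest class of objects that contains `P` and the zero objects and is closed under
shifts and extensions. -/
inductive triClosure (P : ObjectProperty C) : ObjectProperty C
  | of (X : C) (hX : P X) : triClosure P X
  | zero (X : C) (hX : IsZero X) : triClosure P X
  | shift (X : C) (n : ℤ) (hX : triClosure P X) : triClosure P (X⟦n⟧)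
  | ext (T : Triangle C) (hT : T ∈ distTriang C) (h₁ : triClosure P T.obj₁)
      (h₃ : triClosure P T.obj₃) : triClosure P T.obj₂

theorem distinguished_of_iso {X Y : C} (e : X ≅ Y) :
    Triangle.mk e.hom (0 : Y ⟶ 0) 0 ∈ distTriang C :=
  isomorphic_distinguished _ (contractible_distinguished X) _
    (Triangle.isoMk _ _ (Iso.refl _) e.symm (Iso.refl _)
      (by change e.hom ≫ e.inv = 𝟙 X ≫ 𝟙 X; simp)
      (by change (0 : Y ⟶ 0) ≫ 𝟙 _ = e.inv ≫ 0; simp)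
      (by change (0 : (0 : C) ⟶ X⟦(1 : ℤ)⟧) ≫ (shiftFunctor C 1).map (𝟙 X) = 𝟙 _ ≫ 0; simp))

theorem extClosure_of_iso (P : ObjectProperty C) {X Y : C} (e : X ≅ Y)
    (hX : extClosure P X) : extClosure P Y :=
  extClosure.ext _ (distinguished_of_iso e) hX (extClosure.zero _ (isZero_zero C))

theorem triClosure_of_iso (P : ObjectProperty C) {X Y : C} (e : X ≅ Y)
    (hX : triClosure P X) : triClosure P Y :=
  triClosure.ext _ (distinguished_of_iso e) hX (triClosure.zero _ (isZero_zero C))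

instance triClosure_isClosedUnderIsomorphisms (P : ObjectProperty C) :
    (triClosure P).IsClosedUnderIsomorphisms where
  of_iso e hX := triClosure_of_iso P e hX

instance triClosure_isTriangulated (P : ObjectProperty C) : (triClosure P).IsTriangulated where
  exists_zero := ⟨0, isZero_zero C, triClosure.zero _ (isZero_zero C)⟩
  isStableUnderShiftBy n := { le_shift := fun X hX => triClosure.shift X n hX }
  ext₂' T hT h₁ h₃ := ObjectProperty.le_isoClosure _ _ (triClosure.ext T hT h₁ h₃)

end Generation

section Twist

variable {C : Type u} [Category.{v} C]

/-- The twisted object `X⟨k⟩`, for the autoequivalence `F = ⟨1⟩`. -/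
abbrev twist (F : C ≌ C) (k : ℤ) (X : C) : C := (F ^ k).functor.obj X

/-- `C` is graded Hom-finite: each `⨁_k Hom(X, Y⟨k⟩)` is a finitely generated `E`-module. -/
def GradedHomFinite (E : Type w) [CommRing E] [Preadditive C] [Linear E C] (F : C ≌ C) : Prop :=
  ∀ X Y : C, Module.Finite E (DirectSum ℤ fun k => (X ⟶ twist F k Y))

end Twist

section Sequences

variable {C : Type u} [Category.{v} C] [Preadditive C] [HasZeroObject C] [HasShift C ℤ]
  [∀ n : ℤ, (shiftFunctor C n).Additive] [Pretriangulated C]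
  {I : Type w'}

/-- The triangulated subcategory generated by the `∇_j⟨k⟩` with `j` in `S`. -/
def generated (F : C ≌ C) (nabla : I → C) (S : Set I) : ObjectProperty C :=
  triClosure fun X => ∃ j ∈ S, ∃ k : ℤ, X = twist F k (nabla j)

instance generated_isClosedUnderIsomorphisms (F : C ≌ C) (nabla : I → C) (S : Set I) :
    (generated F nabla S).IsClosedUnderIsomorphisms :=
  triClosure_isClosedUnderIsomorphisms _

instance generated_isTriangulated (F : C ≌ C) (nabla : I → C) (S : Set I) :
    (generated F nabla S).IsTriangulated :=
  triClosure_isTriangulated _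

theorem generated_twist_zero (F : C ≌ C) (nabla : I → C) (S : Set I) {j : I} (hj : j ∈ S) :
    generated F nabla S (nabla j) :=
  triClosure.of _ ⟨j, hj, 0, rfl⟩

section Order

variable [LinearOrder I]

/-- A graded exceptional sequence (the index set is moreover required to embed into `ℕ`). -/
structure IsExceptional (E : Type w) [CommRing E] [Linear E C] (F : C ≌ C) (nabla : I → C) :
    Prop where
  index : Nonempty (I ↪o ℕ)
  hom_eq_zero : ∀ i j : I, i < j → ∀ (n k : ℤ) (f : nabla i ⟶ twist F k ((nabla j)⟦n⟧)), f = 0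
  self_hom_eq_zero : ∀ (i : I) (n k : ℤ), ¬(n = 0 ∧ k = 0) →
    ∀ f : nabla i ⟶ twist F k ((nabla i)⟦n⟧), f = 0
  end_equiv : ∀ i : I, Nonempty (End (nabla i) ≃ₐ[E] E)
  generates : ∀ X : C, generated F nabla Set.univ X

/-- The triangulated subcategory `T_{≤ i}`, as a category. -/
abbrev TLE (F : C ≌ C) (nabla : I → C) (i : I) : Type u :=
  (generated F nabla (Set.Iic i)).FullSubcategory

/-- `T_{< i}`, as a triangulated subcategory of `T_{≤ i}`. -/
abbrev TLT (F : C ≌ C) (nabla : I → C) (i : I) : ObjectProperty (TLE F nabla i) :=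
  (generated F nabla (Set.Iio i)).inverseImage (generated F nabla (Set.Iic i)).ι

/-- The Verdier quotient functor `Π_i : T_{≤ i} ⥤ T_{≤ i} / T_{< i}`. -/
abbrev quotientFunctor (F : C ≌ C) (nabla : I → C) (i : I) :
    TLE F nabla i ⥤ (TLT F nabla i).trW.Localization :=
  (TLT F nabla i).trW.Q

/-- `∇_i` as an object of `T_{≤ i}`. -/
abbrev nablaLE (F : C ≌ C) (nabla : I → C) (i : I) : TLE F nabla i :=
  ⟨nabla i, generated_twist_zero F nabla (Set.Iic i) (Set.mem_Iic.mpr le_rfl)⟩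

/-- The family `delta` is a dual sequence to `nabla`. -/
structure IsDual (F : C ≌ C) (nabla delta : I → C) : Prop where
  hom_eq_zero : ∀ i j : I, i < j → ∀ (n k : ℤ) (f : delta j ⟶ twist F k ((nabla i)⟦n⟧)), f = 0
  quotient_iso : ∀ i : I, ∃ h : generated F nabla (Set.Iic i) (delta i),
    Nonempty ((quotientFunctor F nabla i).obj ⟨delta i, h⟩ ≅
      (quotientFunctor F nabla i).obj (nablaLE F nabla i))

end Order

/-- `B` is a model of the object attached to `N`: a cone of `ϖ · id : N ⟶ N` if `E` is not a
field, a zero object if `E` is a field. -/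
def IsReduction {E : Type w} [CommRing E] [Linear E C] (ϖ : E) (N B : C) : Prop :=
  (IsField E ∧ IsZero B) ∨
    (¬ IsField E ∧ ∃ (g : N ⟶ B) (h : B ⟶ N⟦(1 : ℤ)⟧),
      Triangle.mk (ϖ • 𝟙 N) g h ∈ distTriang C)

/-- Generated under extensions by the `Δ_j[n]⟨k⟩` with `n ≥ 0`. -/
def tLE (F : C ≌ C) (delta : I → C) : ObjectProperty C :=
  extClosure fun X => ∃ (j : I) (n k : ℤ), 0 ≤ n ∧ X = twist F k ((delta j)⟦n⟧)

/-- Generated under extensions by the `∇_j[n]⟨k⟩` and the (cone of `ϖ` on `∇_j`)`[n]⟨k⟩`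
with `n ≤ 0`. -/
def tGE {E : Type w} [CommRing E] [Linear E C] (ϖ : E) (F : C ≌ C) (nabla : I → C) :
    ObjectProperty C :=
  extClosure fun X => ∃ (j : I) (n k : ℤ), n ≤ 0 ∧
    (X = twist F k ((nabla j)⟦n⟧) ∨
      ∃ B : C, IsReduction ϖ (nabla j) B ∧ X = twist F k (B⟦n⟧))

end Sequences

end ExcSeq

/-!
All twists `∇_i⟨k⟩` form a single exceptional family, layered by the position of `i` in `I`:
objects of one level do not interact, and the endomorphisms of each object form a valuation ring.

The comparison `Δ_j ⟶ ∇_j` is an isomorphism modulo the lower levels. The octahedral axiom therefore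
writes every object generated by the levels `≤ m` as an iterated extension of nonnegative shifts of
the `Δ_j`, objects of lower level, and negative shifts of the `∇_j` and of the cones of nonzero
endomorphisms of `∇_j`. Induction on `m` then yields the truncation triangles. The cones are forced
by the torsion which cokernels of endomorphisms produce; over a discrete valuation ring each of them
is an iterated extension of cones of `ϖ`.

For a chain of successive quotients `Q_n` of an object `X` of the heart, the submodules of
`Hom(Δ_j⟨k⟩, X)` killed in `Q_n` stabilize simultaneously for all `k`, by graded `Hom`-finiteness.
An object of the heart on which the functors `Hom(Δ_j⟨k⟩, -)` of level `≥ m` vanish is generated by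
the levels `< m`, so the chain stabilizes by descending induction on the level. Over a field the
cones vanish, and the dual argument with `Hom(-, ∇_j⟨k⟩)` gives the descending chain condition.
-/

namespace ExcSeq

open ObjectProperty

local infixr:70 " ∗ " => ObjectProperty.extensionProduct

section Vanishing

variable {C : Type u} [Category.{v} C] [Preadditive C]

theorem hom_eq_zero_of_iso {X Y X' Y' : C} (e : X ≅ X') (e' : Y ≅ Y')
    (h : ∀ f : X' ⟶ Y', f = 0) (f : X ⟶ Y) : f = 0 := by
  rw [← cancel_epi e.inv, ← cancel_mono e'.hom, comp_zero, zero_comp]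
  exact h _

variable [HasShift C ℤ] [∀ n : ℤ, (shiftFunctor C n).Additive]

theorem hom_shift_eq_zero {X Y : C} {a b c : ℤ} (hc : c + a = b)
    (h : ∀ f : X ⟶ Y⟦c⟧, f = 0) (f : X⟦a⟧ ⟶ Y⟦b⟧) : f = 0 := by
  have h' := congrArg (shiftFunctor C a).map
    (h ((shiftFunctor C a).preimage (f ≫ (shiftFunctorAdd' C c a b hc).hom.app Y)))
  rw [Functor.map_preimage, Functor.map_zero] at h'
  rw [← cancel_mono ((shiftFunctorAdd' C c a b hc).hom.app Y), zero_comp, h']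

end Vanishing

section ExtensionProduct

variable {C : Type u} [Category.{v} C] [Preadditive C] [HasZeroObject C] [HasShift C ℤ]
  [∀ n : ℤ, (shiftFunctor C n).Additive] [Pretriangulated C]

theorem distinguished_of_isos {X Y Z X' Y' Z' : C} {f : X ⟶ Y} {g : Y ⟶ Z} {h : Z ⟶ X⟦(1 : ℤ)⟧}
    (hT : Triangle.mk f g h ∈ distTriang C) {f' : X' ⟶ Y'} {g' : Y' ⟶ Z'}
    {h' : Z' ⟶ X'⟦(1 : ℤ)⟧} (α : X' ≅ X) (β : Y' ≅ Y) (γ : Z' ≅ Z)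
    (h₁ : f' ≫ β.hom = α.hom ≫ f) (h₂ : g' ≫ γ.hom = β.hom ≫ g)
    (h₃ : h' ≫ α.hom⟦(1 : ℤ)⟧' = γ.hom ≫ h) : Triangle.mk f' g' h' ∈ distTriang C :=
  isomorphic_distinguished _ hT _ (Triangle.isoMk _ _ α β γ h₁ h₂ h₃)

theorem eq_zero_of_comp_mor₁_eq_zero (T : Triangle C) (hT : T ∈ distTriang C) {W : C}
    {f : W ⟶ T.obj₁} (hf : f ≫ T.mor₁ = 0) (h : ∀ y : W ⟶ T.obj₃⟦(-1 : ℤ)⟧, y = 0) : f = 0 := by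
  obtain ⟨y, rfl⟩ := Triangle.coyoneda_exact₂ _ (inv_rot_of_distTriang _ hT) f hf
  rw [show y = 0 from h y]
  exact zero_comp

theorem extensionProduct_mono {P P' Q Q' : ObjectProperty C} (hP : P ≤ P') (hQ : Q ≤ Q') :
    P ∗ Q ≤ P' ∗ Q' :=
  (monotone_extensionProduct_left Q hP).trans (monotone_extensionProduct_right P' hQ)

theorem extensionProduct_of_distTriang {P Q : ObjectProperty C} (T : Triangle C)
    (hT : T ∈ distTriang C) (h₁ : P T.obj₁) (h₃ : Q T.obj₃) : (P ∗ Q) T.obj₂ :=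
  ⟨T.obj₁, T.obj₃, T.mor₁, T.mor₂, T.mor₃, hT, h₁, h₃⟩

theorem extensionProduct_swap_of_mor₃_eq_zero {P Q : ObjectProperty C} (T : Triangle C)
    (hT : T ∈ distTriang C) (h₁ : P T.obj₁) (h₃ : Q T.obj₃) (h : T.mor₃ = 0) :
    (Q ∗ P) T.obj₂ := by
  obtain ⟨e, -, -⟩ := exists_iso_binaryBiproduct_of_distTriang T hT h
  exact (Q ∗ P).prop_of_iso ((biprod.braiding _ _) ≪≫ e.symm)
    (extensionProduct_of_distTriang (binaryBiproductTriangle T.obj₃ T.obj₁)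
      (binaryBiproductTriangle_distinguished _ _) h₃ h₁)

theorem extensionProduct_swap {P Q : ObjectProperty C}
    (h : ∀ Y, P Y → Q.rightOrthogonal (Y⟦(1 : ℤ)⟧)) : P ∗ Q ≤ Q ∗ P := by
  rintro X ⟨Y, Z, f, g, k, hT, hY, hZ⟩
  exact extensionProduct_swap_of_mor₃_eq_zero (Triangle.mk f g k) hT hY hZ (h Y hY k hZ)

theorem right_of_extensionProduct {P Q : ObjectProperty C} [Q.IsClosedUnderIsomorphisms] {X : C}
    (hPQ : ∀ B, Q B → P.rightOrthogonal (B⟦(-1 : ℤ)⟧)) (hPX : P.rightOrthogonal X)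
    (hX : (P ∗ Q) X) : Q X := by
  obtain ⟨A, B, f, g, k, hT, hA, hB⟩ := hX
  have hA₀ : IsZero A := by
    obtain ⟨s, hs⟩ := Triangle.coyoneda_exact₂ _ (inv_rot_of_distTriang _ hT) (𝟙 A)
      ((Category.id_comp f).trans (hPX f hA))
    rw [IsZero.iff_id_eq_zero]
    exact hs.trans (by rw [show s = 0 from hPQ B hB s hA]; exact zero_comp)
  have : IsIso g := (Triangle.isZero₁_iff_isIso₂ _ hT).1 hA₀
  exact Q.prop_of_iso (asIso g).symm hB

theorem left_of_extensionProduct {P Q : ObjectProperty C} [P.IsClosedUnderIsomorphisms] {X : C}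
    (hPQ : ∀ A, P A → Q.leftOrthogonal (A⟦(1 : ℤ)⟧)) (hXQ : Q.leftOrthogonal X)
    (hX : (P ∗ Q) X) : P X := by
  obtain ⟨A, B, f, g, k, hT, hA, hB⟩ := hX
  have hB₀ : IsZero B := by
    obtain ⟨s, hs⟩ := Triangle.yoneda_exact₃ _ hT (𝟙 B)
      ((Category.comp_id g).trans (hXQ g hB))
    rw [IsZero.iff_id_eq_zero]
    exact hs.trans (by rw [show s = 0 from hPQ A hA s hB]; exact comp_zero)
  have : IsIso f := (Triangle.isZero₃_iff_isIso₁ _ hT).1 hB₀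
  exact P.prop_of_iso (asIso f) hA

instance extensionProduct_containsZero (P Q : ObjectProperty C) [P.ContainsZero]
    [Q.ContainsZero] : (P ∗ Q).ContainsZero where
  exists_zero := by
    obtain ⟨Z, hZ, hP⟩ := P.exists_prop_of_containsZero
    exact ⟨Z, hZ, le_extensionProduct_left Q Z hP⟩

theorem extensionProduct_self_le {P : ObjectProperty C} [P.IsTriangulatedClosed₂]
    [P.IsClosedUnderIsomorphisms] : P ∗ P ≤ P :=
  extensionProduct_le_of_isTriangulatedClosed₂ le_rfl le_rfl

theorem isTriangulatedClosed₂_of_extensionProduct_le {P : ObjectProperty C}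
    [P.IsClosedUnderIsomorphisms] (h : P ∗ P ≤ P) : P.IsTriangulatedClosed₂ :=
  .mk' fun T hT h₁ h₃ => h _ (extensionProduct_of_distTriang T hT h₁ h₃)

section IsTriangulated

variable [IsTriangulated C]

theorem extensionProduct_absorb_left {P P' Q R : ObjectProperty C} (h : P ∗ P' ≤ Q) :
    P ∗ (P' ∗ R) ≤ Q ∗ R := by
  rw [← extensionProduct_assoc]
  exact extensionProduct_mono h le_rfl

theorem extensionProduct_self_left_le {P Q : ObjectProperty C} [P.IsTriangulatedClosed₂]
    [P.IsClosedUnderIsomorphisms] : P ∗ (P ∗ Q) ≤ P ∗ Q :=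
  extensionProduct_absorb_left extensionProduct_self_le

theorem extensionProduct_isTriangulatedClosed₂ {P Q : ObjectProperty C}
    [P.IsTriangulatedClosed₂] [P.IsClosedUnderIsomorphisms]
    [Q.IsTriangulatedClosed₂] [Q.IsClosedUnderIsomorphisms] (h : Q ∗ P ≤ P ∗ Q) :
    (P ∗ Q).IsTriangulatedClosed₂ := by
  refine isTriangulatedClosed₂_of_extensionProduct_le ?_
  calc (P ∗ Q) ∗ (P ∗ Q) = P ∗ (Q ∗ (P ∗ Q)) := extensionProduct_assoc _ _ _
    _ ≤ P ∗ ((P ∗ Q) ∗ Q) := extensionProduct_mono le_rfl (extensionProduct_absorb_left h)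
    _ = P ∗ (P ∗ (Q ∗ Q)) := by rw [extensionProduct_assoc]
    _ ≤ P ∗ (Q ∗ Q) := extensionProduct_self_left_le
    _ ≤ P ∗ Q := extensionProduct_mono le_rfl extensionProduct_self_le

theorem middle_extensionProduct_le {P Q R : ObjectProperty C}
    [Q.IsTriangulatedClosed₂] [Q.IsClosedUnderIsomorphisms] (hQP : Q ∗ P ≤ P ∗ Q) :
    Q ∗ (P ∗ (Q ∗ R)) ≤ P ∗ (Q ∗ R) := by
  refine (extensionProduct_absorb_left hQP).trans ?_
  rw [extensionProduct_assoc]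
  exact extensionProduct_mono le_rfl extensionProduct_self_left_le

theorem extensionProduct_pair_le {P Q R : ObjectProperty C}
    [Q.IsTriangulatedClosed₂] [Q.IsClosedUnderIsomorphisms]
    [R.IsTriangulatedClosed₂] [R.IsClosedUnderIsomorphisms] (hRQ : R ∗ Q ≤ Q ∗ R) :
    (P ∗ (Q ∗ R)) ∗ (Q ∗ R) ≤ P ∗ (Q ∗ R) := by
  have := extensionProduct_isTriangulatedClosed₂ hRQ
  rw [extensionProduct_assoc]
  exact extensionProduct_mono le_rfl extensionProduct_self_le

theorem extensionProduct_triple_isTriangulatedClosed₂ {P Q R : ObjectProperty C}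
    [P.IsTriangulatedClosed₂] [P.IsClosedUnderIsomorphisms]
    [Q.IsTriangulatedClosed₂] [Q.IsClosedUnderIsomorphisms]
    [R.IsTriangulatedClosed₂] [R.IsClosedUnderIsomorphisms] (hQP : Q ∗ P ≤ P ∗ Q)
    (hRQ : R ∗ Q ≤ Q ∗ R) (hRP : R ∗ P ≤ P ∗ (Q ∗ R)) :
    (P ∗ (Q ∗ R)).IsTriangulatedClosed₂ := by
  refine isTriangulatedClosed₂_of_extensionProduct_le ?_
  have hR : R ∗ (P ∗ (Q ∗ R)) ≤ P ∗ (Q ∗ R) :=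
    (extensionProduct_absorb_left hRP).trans (extensionProduct_pair_le hRQ)
  calc (P ∗ (Q ∗ R)) ∗ (P ∗ (Q ∗ R)) = P ∗ (Q ∗ (R ∗ (P ∗ (Q ∗ R)))) := by
        rw [extensionProduct_assoc, extensionProduct_assoc]
    _ ≤ P ∗ (Q ∗ (P ∗ (Q ∗ R))) := extensionProduct_mono le_rfl (extensionProduct_mono le_rfl hR)
    _ ≤ P ∗ (P ∗ (Q ∗ R)) := extensionProduct_mono le_rfl (middle_extensionProduct_le hQP)
    _ ≤ P ∗ (Q ∗ R) := extensionProduct_self_left_le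

end IsTriangulated

end ExtensionProduct

section Closures

variable {C : Type u} [Category.{v} C] [Preadditive C] [HasZeroObject C] [HasShift C ℤ]
  [∀ n : ℤ, (shiftFunctor C n).Additive] [Pretriangulated C]

instance extClosure_isClosedUnderIsomorphisms (P : ObjectProperty C) :
    (extClosure P).IsClosedUnderIsomorphisms where
  of_iso e hX := extClosure_of_iso P e hX

instance extClosure_isTriangulatedClosed₂ (P : ObjectProperty C) :
    (extClosure P).IsTriangulatedClosed₂ :=
  .mk' fun T hT h₁ h₃ => extClosure.ext T hT h₁ h₃

instance extClosure_containsZero (P : ObjectProperty C) : (extClosure P).ContainsZero where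
  exists_zero := ⟨0, isZero_zero C, extClosure.zero _ (isZero_zero C)⟩

theorem le_extClosure (P : ObjectProperty C) : P ≤ extClosure P :=
  fun X hX => extClosure.of X hX

theorem extClosure_le {P Q : ObjectProperty C} [Q.ContainsZero] [Q.IsClosedUnderIsomorphisms]
    [Q.IsTriangulatedClosed₂] (h : P ≤ Q) : extClosure P ≤ Q := by
  intro X hX
  induction hX with
  | of X hX => exact h X hX
  | zero X hX => exact Q.prop_of_isZero hX
  | ext T hT _ _ ih₁ ih₃ => exact Q.ext_of_isTriangulatedClosed₂ T hT ih₁ ih₃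

theorem extClosure_mono {P Q : ObjectProperty C} (h : P ≤ Q) : extClosure P ≤ extClosure Q :=
  extClosure_le (h.trans (le_extClosure Q))

theorem extClosure_shift {P Q : ObjectProperty C} (n : ℤ)
    (h : ∀ X, P X → extClosure Q (X⟦n⟧)) {X : C} (hX : extClosure P X) :
    extClosure Q (X⟦n⟧) := by
  induction hX with
  | of X hX => exact h X hX
  | zero X hX => exact extClosure.zero _ ((shiftFunctor C n).map_isZero hX)
  | ext T hT _ _ ih₁ ih₃ =>
    exact extClosure.ext _ (Triangle.shift_distinguished T hT n) ih₁ ih₃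

theorem triClosure_le_of_shift {P Q : ObjectProperty C} [Q.ContainsZero]
    [Q.IsClosedUnderIsomorphisms] [Q.IsTriangulatedClosed₂]
    (h : ∀ X, P X → ∀ n : ℤ, Q (X⟦n⟧)) : triClosure P ≤ Q := by
  suffices ∀ X, triClosure P X → ∀ n : ℤ, Q (X⟦n⟧) from fun X hX =>
    Q.prop_of_iso ((shiftFunctorZero C ℤ).app X) (this X hX 0)
  intro X hX
  induction hX with
  | of X hX => exact h X hX
  | zero X hX => exact fun n => Q.prop_of_isZero ((shiftFunctor C n).map_isZero hX)
  | shift X m _ ih =>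
    exact fun n => Q.prop_of_iso ((shiftFunctorAdd' C m n (m + n) rfl).app X) (ih (m + n))
  | ext T hT _ _ ih₁ ih₃ =>
    exact fun n => Q.ext_of_isTriangulatedClosed₂ _ (Triangle.shift_distinguished T hT n)
      (ih₁ n) (ih₃ n)

theorem triClosure_le {P Q : ObjectProperty C} [Q.IsTriangulated] [Q.IsClosedUnderIsomorphisms]
    (h : P ≤ Q) : triClosure P ≤ Q :=
  triClosure_le_of_shift fun X hX n => Q.le_shift n X (h X hX)

theorem triClosure_mono {P Q : ObjectProperty C} (h : P ≤ Q) : triClosure P ≤ triClosure Q :=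
  triClosure_le (h.trans fun X hX => triClosure.of X hX)

theorem rightOrthogonal_triClosure {P : ObjectProperty C} {Y : C}
    (h : ∀ X, P X → ∀ (n : ℤ) (f : X ⟶ Y⟦n⟧), f = 0) : (triClosure P).rightOrthogonal Y := by
  suffices triClosure P ≤ leftOrthogonal fun Z => Z = Y from fun X f hX => this X hX f rfl
  refine triClosure_le_of_shift ?_
  rintro X hX n _ f rfl
  exact hom_eq_zero_of_iso (Iso.refl _) ((shiftFunctorZero C ℤ).symm.app _)
    (hom_shift_eq_zero (neg_add_cancel n) (h X hX _)) f

theorem leftOrthogonal_triClosure {P : ObjectProperty C} {X : C}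
    (h : ∀ Y, P Y → ∀ (n : ℤ) (f : X ⟶ Y⟦n⟧), f = 0) : (triClosure P).leftOrthogonal X := by
  suffices triClosure P ≤ rightOrthogonal fun Z => Z = X from fun Y f hY => this Y hY f rfl
  refine triClosure_le_of_shift ?_
  rintro Y hY n _ f rfl
  exact h Y hY n f

theorem rightOrthogonal_extClosure {P : ObjectProperty C} {Y : C} (hY : P.rightOrthogonal Y) :
    (extClosure P).rightOrthogonal Y := by
  suffices extClosure P ≤ leftOrthogonal fun Z => Z = Y from fun X f hX => this X hX f rfl
  refine extClosure_le ?_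
  rintro X hX _ f rfl
  exact hY f hX

theorem leftOrthogonal_extClosure {P : ObjectProperty C} {X : C} (hX : P.leftOrthogonal X) :
    (extClosure P).leftOrthogonal X := by
  suffices extClosure P ≤ rightOrthogonal fun Z => Z = X from fun Y f hY => this Y hY f rfl
  refine extClosure_le ?_
  rintro Y hY _ f rfl
  exact hX f hY

section IsTriangulated

variable [IsTriangulated C]

theorem extClosure_extensionProduct_le {G Q R : ObjectProperty C} [R.IsClosedUnderIsomorphisms]
    (hG : G ∗ Q ≤ R) (h₀ : Q ≤ R) (hR : ∀ V : ObjectProperty C, V ∗ Q ≤ R → V ∗ R ≤ R) :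
    extClosure G ∗ Q ≤ R := by
  suffices ∀ X, extClosure G X → (fun Y => Y = X) ∗ Q ≤ R by
    rintro X ⟨Y, Z, f, g, k, hT, hY, hZ⟩
    exact this Y hY X ⟨Y, Z, f, g, k, hT, rfl, hZ⟩
  intro X hX
  induction hX with
  | of X hX =>
    refine (extensionProduct_mono ?_ le_rfl).trans hG
    rintro _ rfl
    exact hX
  | zero X hX =>
    rintro Z ⟨_, Y, f, g, k, hT, rfl, hY⟩
    have : IsIso g := (Triangle.isZero₁_iff_isIso₂ _ hT).1 hX
    exact R.prop_of_iso (asIso g).symm (h₀ Y hY)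
  | ext T hT _ _ ih₁ ih₃ =>
    refine le_trans (extensionProduct_mono (P' := (fun Y => Y = T.obj₁) ∗ (fun Y => Y = T.obj₃))
      ?_ le_rfl) ?_
    · rintro _ rfl
      exact extensionProduct_of_distTriang T hT rfl rfl
    · rw [extensionProduct_assoc]
      exact (extensionProduct_mono le_rfl ih₃).trans (hR _ ih₁)

theorem extensionProduct_extClosure_le {G Q R : ObjectProperty C} [R.IsClosedUnderIsomorphisms]
    (hG : Q ∗ G ≤ R) (h₀ : Q ≤ R) (hR : ∀ V : ObjectProperty C, Q ∗ V ≤ R → R ∗ V ≤ R) :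
    Q ∗ extClosure G ≤ R := by
  suffices ∀ X, extClosure G X → Q ∗ (fun Y => Y = X) ≤ R by
    rintro X ⟨Y, Z, f, g, k, hT, hY, hZ⟩
    exact this Z hZ X ⟨Y, Z, f, g, k, hT, hY, rfl⟩
  intro X hX
  induction hX with
  | of X hX =>
    refine (extensionProduct_mono le_rfl ?_).trans hG
    rintro _ rfl
    exact hX
  | zero X hX =>
    rintro Z ⟨Y, _, f, g, k, hT, hY, rfl⟩
    have : IsIso f := (Triangle.isZero₃_iff_isIso₁ _ hT).1 hX
    exact R.prop_of_iso (asIso f) (h₀ Y hY)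
  | ext T hT _ _ ih₁ ih₃ =>
    refine le_trans (extensionProduct_mono (Q' := (fun Y => Y = T.obj₁) ∗ (fun Y => Y = T.obj₃))
      le_rfl ?_) ?_
    · rintro _ rfl
      exact extensionProduct_of_distTriang T hT rfl rfl
    · rw [← extensionProduct_assoc]
      exact (extensionProduct_mono ih₁ le_rfl).trans (hR _ ih₃)

end IsTriangulated

end Closures

section EndCone

variable {C : Type u} [Category.{v} C] [Preadditive C] [HasZeroObject C] [HasShift C ℤ]
  [∀ n : ℤ, (shiftFunctor C n).Additive] [Pretriangulated C]

/-- The cones of the nonzero endomorphisms of `X`. When `End X` is a discrete valuation ring these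
are the iterated extensions of the cone of a uniformizer, but they need no choice of one. -/
def endCone (X : C) : ObjectProperty C :=
  fun B => ∃ (p : X ⟶ X) (g : X ⟶ B) (h : B ⟶ X⟦(1 : ℤ)⟧),
    p ≠ 0 ∧ Triangle.mk p g h ∈ distTriang C

theorem endCone_fiber_of_factor [IsTriangulated C] {X B Q : C} (hX : ∀ f : X ⟶ X⟦(1 : ℤ)⟧, f = 0)
    (hfactor : ∀ p q : X ⟶ X, (∃ v, p = v ≫ q) ∨ ∃ v, q = v ≫ p) (hB : endCone X B)
    {i : Q ⟶ X} {q : X ⟶ B} {d : B ⟶ Q⟦(1 : ℤ)⟧} (hQ : Triangle.mk i q d ∈ distTriang C)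
    (hq : q ≠ 0) :
    ∃ U, endCone X U ∧ extensionProduct (fun Y => Y = X) (fun Y => Y = U⟦(-1 : ℤ)⟧) Q := by
  obtain ⟨p, g, h, hp, hT⟩ := hB
  obtain ⟨u, rfl⟩ : ∃ u, q = u ≫ g := Triangle.coyoneda_exact₃ _ hT q (hX _)
  have hpg : p ≫ g = 0 := comp_distTriang_mor_zero₁₂ _ hT
  obtain ⟨v, rfl⟩ | ⟨v, rfl⟩ := hfactor p u
  · obtain ⟨V, a, b, hV⟩ := distinguished_cocone_triangle v
    obtain ⟨U, a', b', hU⟩ := distinguished_cocone_triangle u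
    have o := Triangulated.someOctahedron rfl hV hU hT
    have o' := Triangulated.someOctahedron' o.comm₁ hV (inv_rot_of_distTriang _ o.mem) hQ
    refine ⟨U, ⟨u, a', b', ?_, hU⟩, extensionProduct_of_distTriang _ o'.mem rfl rfl⟩
    rintro rfl
    exact hp comp_zero
  · exact absurd (by rw [Category.assoc, hpg, comp_zero]) hq

theorem endCone.isZero {X B : C} (hX : ∀ p : X ⟶ X, p ≠ 0 → IsIso p) (hB : endCone X B) :
    IsZero B := by
  obtain ⟨p, g, h, hp, hT⟩ := hB
  exact Triangle.isZero₃_of_isIso₁ _ hT (hX p hp)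

end EndCone

section BelowLevel

variable {C : Type u} [Category.{v} C] [Preadditive C] [HasZeroObject C] [HasShift C ℤ]
  [∀ n : ℤ, (shiftFunctor C n).Additive] [Pretriangulated C] {J : Type w'}

/-- The triangulated subcategory generated by the objects `N j` of level less than `m`: the
analogue of `T_{< i}`, with `ℕ`-valued levels so that all `∇_i⟨k⟩`, `k ∈ ℤ`, share a level. -/
def belowLevel (lvl : J → ℕ) (N : J → C) (m : ℕ) : ObjectProperty C :=
  triClosure fun X => ∃ j, lvl j < m ∧ X = N j

variable {lvl : J → ℕ} {N : J → C}

instance belowLevel_isTriangulated (m : ℕ) : (belowLevel lvl N m).IsTriangulated :=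
  triClosure_isTriangulated _

instance belowLevel_isClosedUnderIsomorphisms (m : ℕ) :
    (belowLevel lvl N m).IsClosedUnderIsomorphisms :=
  triClosure_isClosedUnderIsomorphisms _

theorem belowLevel_mono {m m' : ℕ} (h : m ≤ m') : belowLevel lvl N m ≤ belowLevel lvl N m' :=
  triClosure_mono fun _ ⟨j, hj, hX⟩ => ⟨j, hj.trans_le h, hX⟩

theorem mem_belowLevel {j : J} {m : ℕ} (h : lvl j < m) : belowLevel lvl N m (N j) :=
  triClosure.of _ ⟨j, h, rfl⟩

theorem isZero_of_belowLevel_zero {X : C} (hX : belowLevel lvl N 0 X) : IsZero X := by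
  have hX₀ : (belowLevel lvl N 0).leftOrthogonal X :=
    leftOrthogonal_triClosure fun _ ⟨_, hj, _⟩ => absurd hj (Nat.not_lt_zero _)
  rw [IsZero.iff_id_eq_zero]
  exact hX₀ _ hX

end BelowLevel

section DualPair

variable {C : Type u} [Category.{v} C] [Preadditive C] [HasZeroObject C] [HasShift C ℤ]
  [∀ n : ℤ, (shiftFunctor C n).Additive] [Pretriangulated C] {J : Type w'}

/-- An exceptional family `N`, layered by `lvl`, together with a dual family `D`. This is an
ungraded form of a dualizable graded exceptional sequence, in which the twists `∇_i⟨k⟩` are members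
of the family in their own right. The last two fields say that the endomorphism rings are
valuation rings, the only property of the ground ring that the t-structure depends on. -/
structure IsDualPair (lvl : J → ℕ) (N D : J → C) : Prop where
  hom_eq_zero : ∀ (i j : J) (n : ℤ) (f : N i ⟶ (N j)⟦n⟧), lvl i ≤ lvl j →
    ¬(i = j ∧ n = 0) → f = 0
  dual_hom_eq_zero : ∀ (i j : J) (n : ℤ) (f : D j ⟶ (N i)⟦n⟧), lvl i < lvl j → f = 0
  generates : ∀ X : C, ∃ m : ℕ, belowLevel lvl N m X
  exists_comparison : ∀ j, ∃ c : D j ⟶ N j, (belowLevel lvl N (lvl j)).trW c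
  comp_eq_zero : ∀ (j : J) (p q : N j ⟶ N j), p ≫ q = 0 → p = 0 ∨ q = 0
  factor : ∀ (j : J) (p q : N j ⟶ N j), (∃ v, p = v ≫ q) ∨ ∃ v, q = v ≫ p

namespace IsDualPair

variable {lvl : J → ℕ} {N D : J → C}

theorem comparison_bijective {j : J} {c : D j ⟶ N j} (hc : (belowLevel lvl N (lvl j)).trW c)
    {Y : C} (hY : (belowLevel lvl N (lvl j)).rightOrthogonal Y) :
    Function.Bijective (fun f : N j ⟶ Y => c ≫ f) := by
  rw [← isLocal_trW] at hY
  exact hY c hc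

variable (hp : IsDualPair lvl N D)

include hp

theorem dual_mem_belowLevel (j : J) : belowLevel lvl N (lvl j + 1) (D j) := by
  obtain ⟨c, Z, g, h, hT, hZ⟩ := hp.exists_comparison j
  exact (belowLevel lvl N (lvl j + 1)).ext_of_isTriangulatedClosed₁ _ hT
    (mem_belowLevel (Nat.lt_succ_self _)) (belowLevel_mono (Nat.le_succ _) _ hZ)

theorem dual_mem_leftOrthogonal {j : J} {m : ℕ} (hm : m ≤ lvl j) :
    (belowLevel lvl N m).leftOrthogonal (D j) := by
  refine leftOrthogonal_triClosure ?_
  rintro _ ⟨i, hi, rfl⟩ n f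
  exact hp.dual_hom_eq_zero i j n f (hi.trans_le hm)

theorem mem_rightOrthogonal {j : J} {m : ℕ} (hm : m ≤ lvl j) :
    (belowLevel lvl N m).rightOrthogonal (N j) := by
  refine rightOrthogonal_triClosure ?_
  rintro _ ⟨i, hi, rfl⟩ n f
  have hij : lvl i < lvl j := hi.trans_le hm
  exact hp.hom_eq_zero i j n f hij.le fun h => hij.ne (congrArg lvl h.1)

theorem endCone_mem_rightOrthogonal {j : J} {m : ℕ} (hm : m ≤ lvl j) {B : C}
    (hB : endCone (N j) B) : (belowLevel lvl N m).rightOrthogonal B := by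
  obtain ⟨p, g, h, -, hT⟩ := hB
  exact ext_of_isTriangulatedClosed₃ _ _ hT (hp.mem_rightOrthogonal hm) (hp.mem_rightOrthogonal hm)

theorem hom_dual_exc {i j : J} {n : ℤ} (h : ¬(i = j ∧ n = 0)) (f : D i ⟶ (N j)⟦n⟧) : f = 0 := by
  have hN {m : ℕ} (hm : m ≤ lvl j) : (belowLevel lvl N m).rightOrthogonal ((N j)⟦n⟧) :=
    le_shift _ n _ (hp.mem_rightOrthogonal hm)
  obtain hij | hij | hij := lt_trichotomy (lvl i) (lvl j)
  · exact hN hij f (hp.dual_mem_belowLevel i)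
  · obtain ⟨c, hc⟩ := hp.exists_comparison i
    obtain ⟨g, rfl⟩ := (comparison_bijective hc (hN hij.le)).2 f
    simp only [hp.hom_eq_zero i j n g hij.le h, comp_zero]
  · exact hp.dual_hom_eq_zero j i n f hij

theorem hom_dual_endCone_shift_neg_one {j : J} {B : C} (hB : endCone (N j) B)
    (f : D j ⟶ B⟦(-1 : ℤ)⟧) : f = 0 := by
  obtain ⟨p, g, h, hp₀, hT⟩ := hB
  obtain ⟨c, hc⟩ := hp.exists_comparison j
  have hbij := comparison_bijective hc (hp.mem_rightOrthogonal le_rfl)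
  have hT' := inv_rot_of_distTriang _ hT
  set a : B⟦(-1 : ℤ)⟧ ⟶ N j := (Triangle.mk p g h).invRotate.mor₁
  have hap : a ≫ p = 0 := comp_distTriang_mor_zero₁₂ _ hT'
  have hfa : f ≫ a = 0 := by
    obtain ⟨q, hq : c ≫ q = f ≫ a⟩ := hbij.2 (f ≫ a)
    have hqp : q ≫ p = 0 := hbij.1 <| by
      change c ≫ q ≫ p = c ≫ 0
      rw [reassoc_of% hq, hap, comp_zero, comp_zero]
    rw [← hq, (hp.comp_eq_zero j q p hqp).resolve_right hp₀, comp_zero]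
  exact eq_zero_of_comp_mor₁_eq_zero _ hT' hfa fun y => hp.hom_dual_exc (by simp) y

theorem hom_dual_endCone {i j : J} {n : ℤ} (h : ¬(i = j ∧ n = 0)) {B : C} (hB : endCone (N j) B)
    (f : D i ⟶ B⟦n⟧) : f = 0 := by
  by_cases h' : i = j ∧ n = -1
  · obtain ⟨rfl, rfl⟩ := h'
    exact hp.hom_dual_endCone_shift_neg_one hB f
  · obtain ⟨p, g, k, -, hT⟩ := hB
    have hN (y : D i ⟶ (N j)⟦n⟧⟦(1 : ℤ)⟧) : y = 0 :=
      hom_eq_zero_of_iso (Iso.refl _) ((shiftFunctorAdd' C n 1 (n + 1) rfl).symm.app (N j))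
        (hp.hom_dual_exc (by lia)) y
    obtain ⟨y, rfl⟩ := Triangle.coyoneda_exact₃ _ (Triangle.shift_distinguished _ hT n) f (hN _)
    rw [show y = 0 from hp.hom_dual_exc h y]
    exact zero_comp

theorem hom_dual_excGen {i j : J} {n : ℤ} (h : ¬(i = j ∧ n = 0)) {B : C}
    (hB : B = N j ∨ endCone (N j) B) (f : D i ⟶ B⟦n⟧) : f = 0 := by
  obtain rfl | hB := hB
  · exact hp.hom_dual_exc h f
  · exact hp.hom_dual_endCone h hB f

end IsDualPair

end DualPair

section Generators

variable {C : Type u} [Category.{v} C] [HasShift C ℤ] {J : Type w'}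

/-- The objects `D j[n]` with `j ∈ s` and `n ≥ -a`, up to isomorphism. -/
def dualGen (D : J → C) (s : Set J) (a : ℤ) : ObjectProperty C :=
  fun X => ∃ j ∈ s, ∃ n : ℤ, -a ≤ n ∧ Nonempty (X ≅ (D j)⟦n⟧)

theorem dualGen_self {D : J → C} {s : Set J} {j : J} (hj : j ∈ s) : dualGen D s 0 (D j) :=
  ⟨j, hj, 0, by simp, ⟨(shiftFunctorZero C ℤ).symm.app (D j)⟩⟩

variable [Preadditive C] [HasZeroObject C] [∀ n : ℤ, (shiftFunctor C n).Additive]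
  [Pretriangulated C]

/-- The objects `N j[n]` and `B[n]`, with `B` the cone of a nonzero endomorphism of `N j`, for
`j ∈ s` and `n ≤ -a`, up to isomorphism. -/
def excGen (N : J → C) (s : Set J) (a : ℤ) : ObjectProperty C :=
  fun X => ∃ j ∈ s, ∃ n : ℤ, n ≤ -a ∧ ∃ B : C, (B = N j ∨ endCone (N j) B) ∧ Nonempty (X ≅ B⟦n⟧)

/-- The part with indices in `s` of the aisle `T^{≤ a}`; the set `s` allows an induction on
levels. -/
def dualLE (D : J → C) (s : Set J) (a : ℤ) : ObjectProperty C := extClosure (dualGen D s a)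

/-- The part with indices in `s` of the coaisle `T^{≥ a}`; the set `s` allows an induction on
levels. -/
def excGE (N : J → C) (s : Set J) (a : ℤ) : ObjectProperty C := extClosure (excGen N s a)

/-- The zero objects and the objects `D j[n]` with `j ∈ s` and `n ≥ 0`: at most one generator of
`dualLE D s 0`, so that generators can be commuted past the coaisle one at a time. -/
def dualLetter (D : J → C) (s : Set J) : ObjectProperty C :=
  fun X => IsZero X ∨ dualGen D s 0 X

variable {N D : J → C}

theorem dualLE_mono {s s' : Set J} (hs : s ⊆ s') {a a' : ℤ} (h : a ≤ a') :
    dualLE D s a ≤ dualLE D s' a' :=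
  extClosure_mono fun _ ⟨j, hj, n, hn, e⟩ => ⟨j, hs hj, n, by lia, e⟩

theorem excGE_mono {s s' : Set J} (hs : s ⊆ s') {a a' : ℤ} (h : a' ≤ a) :
    excGE N s a ≤ excGE N s' a' :=
  extClosure_mono fun _ ⟨j, hj, n, hn, e⟩ => ⟨j, hs hj, n, by lia, e⟩

theorem dualLE_shift {s : Set J} {n a n' : ℤ} (h : a + n' = n) {X : C} (hX : dualLE D s n X) :
    dualLE D s n' (X⟦a⟧) := by
  refine extClosure_shift a ?_ hX
  rintro X ⟨j, hj, m, hm, ⟨e⟩⟩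
  exact extClosure.of _ ⟨j, hj, m + a, by lia,
    ⟨(shiftFunctor C a).mapIso e ≪≫ ((shiftFunctorAdd' C m a (m + a) rfl).app (D j)).symm⟩⟩

theorem excGE_shift {s : Set J} {n a n' : ℤ} (h : a + n' = n) {X : C} (hX : excGE N s n X) :
    excGE N s n' (X⟦a⟧) := by
  refine extClosure_shift a ?_ hX
  rintro X ⟨j, hj, m, hm, B, hB, ⟨e⟩⟩
  exact extClosure.of _ ⟨j, hj, m + a, by lia, B, hB,
    ⟨(shiftFunctor C a).mapIso e ≪≫ ((shiftFunctorAdd' C m a (m + a) rfl).app B).symm⟩⟩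

instance dualLE_isClosedUnderIsomorphisms (s : Set J) (a : ℤ) :
    (dualLE D s a).IsClosedUnderIsomorphisms :=
  extClosure_isClosedUnderIsomorphisms _

instance dualLE_isTriangulatedClosed₂ (s : Set J) (a : ℤ) :
    (dualLE D s a).IsTriangulatedClosed₂ :=
  extClosure_isTriangulatedClosed₂ _

instance dualLE_containsZero (s : Set J) (a : ℤ) : (dualLE D s a).ContainsZero :=
  extClosure_containsZero _

instance excGE_isClosedUnderIsomorphisms (s : Set J) (a : ℤ) :
    (excGE N s a).IsClosedUnderIsomorphisms :=
  extClosure_isClosedUnderIsomorphisms _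

instance excGE_isTriangulatedClosed₂ (s : Set J) (a : ℤ) :
    (excGE N s a).IsTriangulatedClosed₂ :=
  extClosure_isTriangulatedClosed₂ _

instance excGE_containsZero (s : Set J) (a : ℤ) : (excGE N s a).ContainsZero :=
  extClosure_containsZero _

instance dualLetter_containsZero (s : Set J) : (dualLetter D s).ContainsZero where
  exists_zero := ⟨0, isZero_zero C, Or.inl (isZero_zero C)⟩

theorem excGen_self {s : Set J} {j : J} (hj : j ∈ s) : excGen N s 0 (N j) :=
  ⟨j, hj, 0, by simp, N j, Or.inl rfl, ⟨(shiftFunctorZero C ℤ).symm.app (N j)⟩⟩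

theorem dualLetter_le (s : Set J) : dualLetter D s ≤ dualLE D s 0 := by
  rintro X (h | h)
  · exact extClosure.zero X h
  · exact extClosure.of X h

end Generators

section Truncation

variable {C : Type u} [Category.{v} C] [Preadditive C] [HasZeroObject C] [HasShift C ℤ]
  [∀ n : ℤ, (shiftFunctor C n).Additive] [Pretriangulated C]
  {J : Type w'} {lvl : J → ℕ} {N D : J → C}

namespace IsDualPair

variable (hp : IsDualPair lvl N D)

include hp

theorem dualLE_le_leftOrthogonal {m : ℕ} {s : Set J} (hs : ∀ j ∈ s, m ≤ lvl j) (a : ℤ) :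
    dualLE D s a ≤ (belowLevel lvl N m).leftOrthogonal := by
  refine extClosure_le ?_
  rintro X ⟨j, hj, n, -, ⟨e⟩⟩
  exact prop_of_iso _ e.symm (le_shift _ n _ (hp.dual_mem_leftOrthogonal (hs j hj)))

theorem excGE_le_rightOrthogonal {m : ℕ} {s : Set J} (hs : ∀ j ∈ s, m ≤ lvl j) (a : ℤ) :
    excGE N s a ≤ (belowLevel lvl N m).rightOrthogonal := by
  refine extClosure_le ?_
  rintro X ⟨j, hj, n, -, B, hB, ⟨e⟩⟩
  have hB' : (belowLevel lvl N m).rightOrthogonal B := by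
    obtain rfl | hB := hB
    · exact hp.mem_rightOrthogonal (hs j hj)
    · exact hp.endCone_mem_rightOrthogonal (hs j hj) hB
  exact prop_of_iso _ e.symm (le_shift _ n _ hB')

theorem belowLevel_dualLE_swap {m : ℕ} {s : Set J} (hs : ∀ j ∈ s, m ≤ lvl j)
    {P : ObjectProperty C} (hP : P ≤ dualLE D s 0) :
    belowLevel lvl N m ∗ P ≤ P ∗ belowLevel lvl N m :=
  extensionProduct_swap fun _ hY X f hX =>
    hp.dualLE_le_leftOrthogonal hs 0 X (hP X hX) f (le_shift _ 1 _ hY)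

theorem excGE_belowLevel_swap {m : ℕ} {s : Set J} (hs : ∀ j ∈ s, m ≤ lvl j) (a : ℤ) :
    excGE N s a ∗ belowLevel lvl N m ≤ belowLevel lvl N m ∗ excGE N s a :=
  extensionProduct_swap fun Y hY => le_shift _ 1 _ (hp.excGE_le_rightOrthogonal hs a Y hY)

theorem exc_mem_dual_extensionProduct {j : J} {s : Set J} (hs : j ∈ s) :
    (dualLetter D s ∗ belowLevel lvl N (lvl j)) (N j) := by
  obtain ⟨c, Z, g, h, hT, hZ⟩ := hp.exists_comparison j
  exact extensionProduct_of_distTriang _ hT (Or.inr (dualGen_self hs)) hZ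

theorem hom_dualLE_excGE {s s' : Set J} {a b : ℤ} (hab : a < b) {X Y : C}
    (hX : dualLE D s a X) (hY : excGE N s' b Y) (f : X ⟶ Y) : f = 0 := by
  refine rightOrthogonal_extClosure (fun X f hX => ?_) f hX
  refine leftOrthogonal_extClosure (fun Y f hY => ?_) f hY
  obtain ⟨i, -, n, hn, ⟨e⟩⟩ := hX
  obtain ⟨j, -, n', hn', B, hB, ⟨e'⟩⟩ := hY
  exact hom_eq_zero_of_iso e e' (hom_shift_eq_zero (c := n' - n) (by simp)
    (hp.hom_dual_excGen (by lia) hB)) f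

variable [IsTriangulated C]

theorem exc_fiber_mem {j : J} {s : Set J} (hj : j ∈ s) {X Q : C}
    (hX : X = N j ∨ endCone (N j) X) {i : Q ⟶ N j} {q : N j ⟶ X} {d : X ⟶ Q⟦(1 : ℤ)⟧}
    (hQ : Triangle.mk i q d ∈ distTriang C) (hq : q ≠ 0) :
    (dualLetter D s ∗ (belowLevel lvl N (lvl j) ∗ excGE N s 1)) Q := by
  obtain rfl | hX := hX
  · refine le_extensionProduct_right _ _ (le_extensionProduct_right _ _ (extClosure.of _ ?_))
    exact ⟨j, hj, -1, le_rfl, _, Or.inr ⟨q, _, _, hq, rot_of_distTriang _ hQ⟩,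
      ⟨(shiftEquiv C (1 : ℤ)).unitIso.app Q⟩⟩
  · obtain ⟨U, hU, hQU⟩ := endCone_fiber_of_factor
      (fun f => hp.hom_eq_zero j j 1 f le_rfl (by simp)) (hp.factor j) hX hQ hq
    rw [← extensionProduct_assoc]
    refine extensionProduct_mono ?_ ?_ Q hQU
    · rintro _ rfl
      exact hp.exc_mem_dual_extensionProduct hj
    · rintro _ rfl
      exact extClosure.of _ ⟨j, hj, -1, le_rfl, U, Or.inr hU, ⟨Iso.refl _⟩⟩

theorem dual_fiber_mem {j : J} {s : Set J} (hs : ∀ i ∈ s, lvl j ≤ lvl i) (hj : j ∈ s) {X Z : C}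
    (hX : X = N j ∨ endCone (N j) X) {a : Z ⟶ D j} {f : D j ⟶ X} {b : X ⟶ Z⟦(1 : ℤ)⟧}
    (hT : Triangle.mk a f b ∈ distTriang C) (hf : f ≠ 0) :
    (dualLetter D s ∗ (belowLevel lvl N (lvl j) ∗ excGE N s 1)) Z := by
  obtain ⟨c, hc⟩ := hp.exists_comparison j
  have hX' : (belowLevel lvl N (lvl j)).rightOrthogonal X := by
    obtain rfl | hX := hX
    · exact hp.mem_rightOrthogonal le_rfl
    · exact hp.endCone_mem_rightOrthogonal le_rfl hX
  obtain ⟨q, rfl⟩ := (comparison_bijective hc hX').2 f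
  obtain ⟨K, k, k', hK, hKT⟩ := (trW_iff' _ _).1 hc
  obtain ⟨Q, l, l', hQ⟩ := distinguished_cocone_triangle₁ q
  have o := Triangulated.someOctahedron' rfl hK hQ hT
  have hQ' := hp.exc_fiber_mem hj hX hQ fun hq => hf (by simp only [hq, comp_zero])
  exact middle_extensionProduct_le (hp.belowLevel_dualLE_swap hs (dualLetter_le s)) Z
    (extensionProduct_of_distTriang _ o.mem hKT hQ')

theorem excGen_dualLetter_le {m : ℕ} {s : Set J} (hs : ∀ i ∈ s, lvl i = m) :
    excGen N s 1 ∗ dualLetter D s ≤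
      dualLetter D s ∗ (belowLevel lvl N m ∗ excGE N s 1) := by
  have hexc : excGE N s 1 ≤ belowLevel lvl N m ∗ excGE N s 1 := le_extensionProduct_right _
  rintro Z ⟨V, U, f, g, k, hT, hV, hU⟩
  by_cases hk : k = 0
  · exact extensionProduct_mono le_rfl ((le_extClosure _).trans hexc) Z
      (extensionProduct_swap_of_mor₃_eq_zero _ hT hV hU hk)
  obtain ⟨j, hj, n, hn, B, hB, ⟨e⟩⟩ := hV
  obtain hU | ⟨i, hi, n', hn', ⟨e'⟩⟩ := hU
  · exact absurd (hU.eq_of_src _ _) hk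
  have e'' : V⟦(1 : ℤ)⟧ ≅ B⟦n + 1⟧ :=
    (shiftFunctor C 1).mapIso e ≪≫ (shiftFunctorAdd' C n 1 (n + 1) rfl).symm.app B
  by_cases h : i = j ∧ n + 1 - n' = 0
  · obtain ⟨rfl, h⟩ := h
    obtain rfl : n' = 0 := by lia
    obtain rfl : n = -1 := by lia
    let α : U ≅ D i := e' ≪≫ (shiftFunctorZero C ℤ).app (D i)
    let β : V⟦(1 : ℤ)⟧ ≅ B := e'' ≪≫ (shiftFunctorZero C ℤ).app B
    have hrot : Triangle.mk g k (-f⟦(1 : ℤ)⟧') ∈ distTriang C := rot_of_distTriang _ hT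
    have hT' : Triangle.mk (g ≫ α.hom) (α.inv ≫ k ≫ β.hom) (β.inv ≫ (-f⟦(1 : ℤ)⟧')) ∈
        distTriang C :=
      distinguished_of_isos hrot (Iso.refl _) α.symm β.symm
        (by simp) (by simp) (by simp)
    rw [← hs i hi]
    refine hp.dual_fiber_mem (fun i' hi' => (hs i hi).trans_le (hs i' hi').ge) hi hB hT'
      fun h0 => hk ?_
    rw [← cancel_epi α.inv, ← cancel_mono β.hom, Category.assoc, h0, comp_zero, zero_comp]
  · refine absurd (hom_eq_zero_of_iso e' e'' (hom_shift_eq_zero (c := n + 1 - n') (by simp)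
      fun f => ?_) k) hk
    exact hp.hom_dual_excGen h hB f

theorem excGE_dualLE_le {m : ℕ} {s : Set J} (hs : ∀ i ∈ s, lvl i = m) :
    excGE N s 1 ∗ dualLE D s 0 ≤
      dualLE D s 0 ∗ (belowLevel lvl N m ∗ excGE N s 1) := by
  have hs' : ∀ i ∈ s, m ≤ lvl i := fun i hi => (hs i hi).ge
  have hexc : excGE N s 1 ≤ belowLevel lvl N m ∗ excGE N s 1 := le_extensionProduct_right _
  have hletter : excGE N s 1 ∗ dualLetter D s ≤
      dualLetter D s ∗ (belowLevel lvl N m ∗ excGE N s 1) := by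
    refine extClosure_extensionProduct_le (hp.excGen_dualLetter_le hs)
      (le_extensionProduct_left _) fun V hV => ?_
    exact (extensionProduct_absorb_left hV).trans
      (extensionProduct_pair_le (hp.excGE_belowLevel_swap hs' 1))
  refine extensionProduct_extClosure_le ?_ (hexc.trans (le_extensionProduct_right _))
    fun V hV => ?_
  · exact ((extensionProduct_mono le_rfl fun X hX => Or.inr hX).trans hletter).trans
      (extensionProduct_mono (dualLetter_le s) le_rfl)
  · calc (dualLE D s 0 ∗ (belowLevel lvl N m ∗ excGE N s 1)) ∗ V
        = dualLE D s 0 ∗ (belowLevel lvl N m ∗ (excGE N s 1 ∗ V)) := by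
          rw [extensionProduct_assoc, extensionProduct_assoc]
      _ ≤ dualLE D s 0 ∗ (belowLevel lvl N m ∗
          (dualLE D s 0 ∗ (belowLevel lvl N m ∗ excGE N s 1))) :=
          extensionProduct_mono le_rfl (extensionProduct_mono le_rfl hV)
      _ ≤ dualLE D s 0 ∗ (dualLE D s 0 ∗ (belowLevel lvl N m ∗ excGE N s 1)) :=
          extensionProduct_mono le_rfl
            (middle_extensionProduct_le (hp.belowLevel_dualLE_swap hs' le_rfl))
      _ ≤ dualLE D s 0 ∗ (belowLevel lvl N m ∗ excGE N s 1) := extensionProduct_self_left_le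

theorem belowLevel_succ_le (m : ℕ) :
    belowLevel lvl N (m + 1) ≤ dualLE D {j | lvl j = m} 0 ∗
      (belowLevel lvl N m ∗ excGE N {j | lvl j = m} 1) := by
  have hs : ∀ i ∈ {j | lvl j = m}, m ≤ lvl i := fun i hi => (Set.mem_ofPred.1 hi).ge
  have := extensionProduct_triple_isTriangulatedClosed₂ (hp.belowLevel_dualLE_swap hs le_rfl)
    (hp.excGE_belowLevel_swap hs 1) (hp.excGE_dualLE_le fun i hi => hi)
  refine triClosure_le_of_shift ?_
  rintro _ ⟨j, hj, rfl⟩ n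
  obtain hj | hj := Nat.lt_succ_iff_lt_or_eq.1 hj
  · exact le_extensionProduct_right _ _ (le_extensionProduct_left _ _
      (le_shift _ n _ (mem_belowLevel hj)))
  · obtain hn | hn := lt_or_ge n 0
    · exact le_extensionProduct_right _ _ (le_extensionProduct_right _ _
        (extClosure.of _ ⟨j, hj, n, by lia, N j, Or.inl rfl, ⟨Iso.refl _⟩⟩))
    · refine extensionProduct_mono le_rfl (le_extensionProduct_left _) _ ?_
      obtain ⟨c, Z, g, h, hT, hZ⟩ := hp.exists_comparison j
      exact extensionProduct_of_distTriang _ (Triangle.shift_distinguished _ hT n)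
        (extClosure.of _ ⟨j, hj, n, by lia, ⟨Iso.refl _⟩⟩) (le_shift _ n _ (hj ▸ hZ))

theorem belowLevel_le_truncation (m : ℕ) :
    belowLevel lvl N m ≤ dualLE D {j | lvl j < m} 0 ∗ excGE N {j | lvl j < m} 1 := by
  induction m with
  | zero =>
    refine (triClosure_le_of_shift ?_).trans (le_extensionProduct_left _)
    rintro _ ⟨j, hj, -⟩
    simp at hj
  | succ m ih =>
    have h₁ : {j | lvl j = m} ⊆ {j | lvl j < m + 1} := fun j hj => by
      simp only [Set.mem_ofPred_eq] at hj ⊢; lia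
    have h₂ : {j | lvl j < m} ⊆ {j | lvl j < m + 1} := fun j hj => by
      simp only [Set.mem_ofPred_eq] at hj ⊢; lia
    calc belowLevel lvl N (m + 1)
        ≤ dualLE D {j | lvl j = m} 0 ∗ (belowLevel lvl N m ∗ excGE N {j | lvl j = m} 1) :=
          hp.belowLevel_succ_le m
      _ ≤ dualLE D {j | lvl j = m} 0 ∗
          ((dualLE D {j | lvl j < m} 0 ∗ excGE N {j | lvl j < m} 1) ∗
            excGE N {j | lvl j = m} 1) :=
          extensionProduct_mono le_rfl (extensionProduct_mono ih le_rfl)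
      _ = (dualLE D {j | lvl j = m} 0 ∗ dualLE D {j | lvl j < m} 0) ∗
          (excGE N {j | lvl j < m} 1 ∗ excGE N {j | lvl j = m} 1) := by
          rw [extensionProduct_assoc, ← extensionProduct_assoc]
      _ ≤ dualLE D {j | lvl j < m + 1} 0 ∗ excGE N {j | lvl j < m + 1} 1 :=
          extensionProduct_mono
            ((extensionProduct_mono (dualLE_mono h₁ le_rfl) (dualLE_mono h₂ le_rfl)).trans
              extensionProduct_self_le)
            ((extensionProduct_mono (excGE_mono h₂ le_rfl) (excGE_mono h₁ le_rfl)).trans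
              extensionProduct_self_le)

/-- The t-structure whose aisle is generated under extensions by the `D j[n]` with `n ≥ 0`. -/
def tStructure : Triangulated.TStructure C where
  le := dualLE D Set.univ
  ge := excGE N Set.univ
  le_shift n a n' h X hX := dualLE_shift h hX
  ge_shift n a n' h X hX := excGE_shift h hX
  zero' X Y f hX hY := hp.hom_dualLE_excGE zero_lt_one hX hY f
  le_zero_le := dualLE_mono le_rfl zero_le_one
  ge_one_le := excGE_mono le_rfl zero_le_one
  exists_triangle_zero_one A := by
    obtain ⟨m, hm⟩ := hp.generates A
    obtain ⟨X, Y, f, g, h, hT, hX, hY⟩ := hp.belowLevel_le_truncation m A hm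
    exact ⟨X, Y, dualLE_mono (Set.subset_univ _) le_rfl X hX,
      excGE_mono (Set.subset_univ _) le_rfl Y hY, f, g, h, hT⟩

end IsDualPair

end Truncation

section Heart

variable {C : Type u} [Category.{v} C] [Preadditive C] [HasZeroObject C] [HasShift C ℤ]
  [∀ n : ℤ, (shiftFunctor C n).Additive] [Pretriangulated C]
  (t : Triangulated.TStructure C)

instance heart_containsZero : t.heart.ContainsZero where
  exists_zero := ⟨0, isZero_zero C, (t.mem_heart_iff _).2
    ⟨t.isLE_of_isZero (isZero_zero C) 0, t.isGE_of_isZero (isZero_zero C) 0⟩⟩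

instance heart_isTriangulatedClosed₂ : t.heart.IsTriangulatedClosed₂ :=
  .mk' fun T hT h₁ h₃ => by
    rw [t.mem_heart_iff] at h₁ h₃ ⊢
    exact ⟨t.isLE₂ T hT 0 h₁.1 h₃.1, t.isGE₂ T hT 0 h₁.2 h₃.2⟩

instance heart_isClosedUnderBinaryProducts : t.heart.IsClosedUnderBinaryProducts :=
  .mk' <| by
    rintro _ ⟨K, hK⟩
    have e : limit K ≅ K.obj (.mk .left) ⊞ K.obj (.mk .right) :=
      HasLimit.isoOfNatIso (diagramIsoPair K) ≪≫ (biprod.isoProd _ _).symm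
    exact t.heart.prop_of_iso e.symm (t.heart.ext_of_isTriangulatedClosed₂ _
      (binaryBiproductTriangle_distinguished _ _) (hK _) (hK _))

instance heart_isClosedUnderFiniteProducts : t.heart.IsClosedUnderFiniteProducts := .mk'

theorem heart_hom_eq_zero ⦃X Y : t.heart.FullSubcategory⦄ ⦃n : ℤ⦄
    (f : t.heart.ι.obj X ⟶ (t.heart.ι.obj Y)⟦n⟧) (hn : n < 0) : f = 0 := by
  have hX := (t.mem_heart_iff _).1 X.property
  have hY := (t.mem_heart_iff _).1 Y.property
  have := hX.1
  have := hY.2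
  have : t.IsGE ((t.heart.ι.obj Y)⟦n⟧) (-n) := t.isGE_shift Y.obj 0 n (-n)
  exact t.zero_of_isLE_of_isGE f 0 (-n) (by lia) hX.1 this

theorem exists_distTriang_heart_shift_heart (X : C) [t.IsLE X 0] [t.IsGE X (-1)] :
    ∃ (K Q : t.heart.FullSubcategory) (a : K.obj⟦(1 : ℤ)⟧ ⟶ X) (b : X ⟶ Q.obj)
      (c : Q.obj ⟶ K.obj⟦(1 : ℤ)⟧⟦(1 : ℤ)⟧), Triangle.mk a b c ∈ distTriang C := by
  obtain ⟨A, B, hA, hB, a, b, c, hT⟩ := t.exists_triangle X (-1) 0 (by simp)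
  rw [t.le_iff_isLE] at hA
  rw [t.ge_iff_isGE] at hB
  have hB₁ : t.IsGE (B⟦(-1 : ℤ)⟧) 1 := t.isGE_shift B 0 (-1) 1
  have hA₁ : t.IsLE (A⟦(1 : ℤ)⟧) (-2) := t.isLE_shift A (-1) 1 (-2)
  have hA' : t.IsGE A (-1) := t.isGE₂ _ (inv_rot_of_distTriang _ hT) (-1)
    (t.isGE_of_ge (B⟦(-1 : ℤ)⟧) (-1) 1) ‹_›
  have hB' : t.IsLE B 0 := t.isLE₂ _ (rot_of_distTriang _ hT) 0 ‹_›
    (t.isLE_of_le (A⟦(1 : ℤ)⟧) (-2) 0)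
  have hK : t.heart (A⟦(-1 : ℤ)⟧) := (t.mem_heart_iff _).2
    ⟨t.isLE_shift A (-1) (-1) 0, t.isGE_shift A (-1) (-1) 0⟩
  let e : A⟦(-1 : ℤ)⟧⟦(1 : ℤ)⟧ ≅ A := (shiftEquiv C (1 : ℤ)).counitIso.app A
  exact ⟨⟨_, hK⟩, ⟨B, (t.mem_heart_iff _).2 ⟨hB', hB⟩⟩, e.hom ≫ a, b, c ≫ e.inv⟦(1 : ℤ)⟧',
    distinguished_of_isos hT e (Iso.refl _) (Iso.refl _) (by simp) (by simp)
      (by rw [Category.assoc, ← Functor.map_comp]; simp)⟩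

theorem heart_admissibleMorphism :
    Triangulated.AbelianSubcategory.admissibleMorphism t.heart.ι = ⊤ := by
  refine top_unique fun X₁ X₂ f₁ _ X₃ f₂ f₃ hT => ?_
  obtain ⟨_, _⟩ := (t.mem_heart_iff _).1 X₁.property
  obtain ⟨_, _⟩ := (t.mem_heart_iff _).1 X₂.property
  have hrot := rot_of_distTriang _ hT
  have hle : t.IsLE (X₁.obj⟦(1 : ℤ)⟧) (-1) := t.isLE_shift X₁.obj 0 1 (-1)
  have hge : t.IsGE (X₁.obj⟦(1 : ℤ)⟧) (-1) := t.isGE_shift X₁.obj 0 1 (-1)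
  have : t.IsLE X₃ 0 := t.isLE₂ _ hrot 0 ‹_› (t.isLE_of_le (X₁.obj⟦(1 : ℤ)⟧) (-1) 0)
  have : t.IsGE X₃ (-1) := t.isGE₂ _ hrot (-1) (t.isGE_of_ge X₂.obj (-1) 0) hge
  exact exists_distTriang_heart_shift_heart t X₃

variable [IsTriangulated C]

/-- The abelian category structure on the heart of a t-structure. -/
@[reducible]
noncomputable def heartAbelian : Abelian t.heart.FullSubcategory :=
  Triangulated.AbelianSubcategory.abelian t.heart.ι (heart_hom_eq_zero t)
    (heart_admissibleMorphism t)

attribute [local instance] heartAbelian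

theorem heart_exists_distTriang_of_shortExact (S : ShortComplex t.heart.FullSubcategory)
    (hS : S.ShortExact) :
    ∃ δ : S.X₃.obj ⟶ S.X₁.obj⟦(1 : ℤ)⟧, Triangle.mk S.f.hom S.g.hom δ ∈ distTriang C := by
  have := hS.epi_g
  have := hS.mono_f
  obtain ⟨K, i, δ, hT⟩ := Triangulated.AbelianSubcategory.exists_distinguished_triangle_of_epi
    (heart_hom_eq_zero t) (heart_admissibleMorphism t) S.g
  let e : K ≅ S.X₁ := IsLimit.conePointUniqueUpToIso
    (Triangulated.AbelianSubcategory.isLimitKernelForkOfDistTriang (heart_hom_eq_zero t) _ _ _ hT)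
    hS.fIsKernel
  have he : e.hom ≫ S.f = i :=
    IsLimit.conePointUniqueUpToIso_hom_comp _ hS.fIsKernel WalkingParallelPair.zero
  let e' : S.X₁.obj ≅ K.obj := t.heart.ι.mapIso e.symm
  have he' : S.f.hom = e'.hom ≫ i.hom := by
    have : S.f = e.inv ≫ i := by rw [← he, e.inv_hom_id_assoc]
    exact congrArg (fun φ => φ.hom) this
  refine ⟨δ ≫ e'.inv⟦(1 : ℤ)⟧', distinguished_of_isos hT e' (Iso.refl _) (Iso.refl _) ?_ ?_ ?_⟩
  · simpa using he'
  · simp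
  · rw [Category.assoc, ← Functor.map_comp]; simp

end Heart

section NoetherianFamily

variable {A : Type u} [Category.{v} A]

theorem map_map_apply (G : A ⥤ AddCommGrpCat.{w}) {X Y Z : A} {f : X ⟶ Y} {g : Y ⟶ Z} {h : X ⟶ Z}
    (e : f ≫ g = h) (x : G.obj X) : G.map g (G.map f x) = G.map h x := by
  rw [← e, Functor.map_comp, ConcreteCategory.comp_apply]

/-- The objects killed by all the functors `G j` of level at least `m`. -/
def vanishingFrom {J : Type w'} (lvl : J → ℕ) (G : J → A ⥤ AddCommGrpCat.{w}) (m : ℕ) :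
    ObjectProperty A :=
  fun X => ∀ j, m ≤ lvl j → ∀ x : (G j).obj X, x = 0

theorem vanishingFrom_mono {J : Type w'} {lvl : J → ℕ} {G : J → A ⥤ AddCommGrpCat.{w}} {m m' : ℕ}
    (h : m ≤ m') : vanishingFrom lvl G m ≤ vanishingFrom lvl G m' :=
  fun _ hX j hj => hX j (h.trans hj)

variable [Abelian A]

/-- The sequence `ker a ⟶ ker (a ≫ b) ⟶ ker b`, part of Mathlib's `kernelCokernelCompSequence`. -/
noncomputable abbrev kernelCompSequence {X Y Z : A} (a : X ⟶ Y) (b : Y ⟶ Z) : ShortComplex A :=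
  ShortComplex.mk (kernel.map a (a ≫ b) (𝟙 X) b (by simp)) (kernel.map (a ≫ b) b a (𝟙 Z) (by simp))
    ((kernelCokernelCompSequence_exact a b).toIsComplex.zero 0)

theorem kernelCompSequence_shortExact {X Y Z : A} (a : X ⟶ Y) (b : Y ⟶ Z) [Epi a] :
    (kernelCompSequence a b).ShortExact where
  exact := (kernelCokernelCompSequence_exact a b).exact 0
  epi_g := ((kernelCokernelCompSequence_exact a b).exact 1).epi_f
    ((isZero_cokernel_of_epi a).eq_of_tgt _ _)

theorem kernel_shortExact {X Y : A} (f : X ⟶ Y) [Epi f] :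
    (ShortComplex.mk (kernel.ι f) f (kernel.condition f)).ShortExact where
  exact := ShortComplex.exact_of_f_is_kernel _ (kernelIsKernel f)

/-- A family of functors `G j`, layered by `lvl`, whose values satisfy an ascending chain condition
uniformly on each level, and which makes `A` noetherian: it detects zero objects, and a functor of
level `m` is exact on the sequences starting with an object killed by all functors of higher
level. -/
structure IsNoetherianFamily {J : Type w'} (lvl : J → ℕ) (G : J → A ⥤ AddCommGrpCat.{w}) :
    Prop where
  exists_vanishingFrom : ∀ X, ∃ m, vanishingFrom lvl G m X
  isZero : ∀ X, vanishingFrom lvl G 0 X → IsZero X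
  injective : ∀ S : ShortComplex A, S.ShortExact → ∀ j, Function.Injective ((G j).map S.f)
  surjective : ∀ S : ShortComplex A, S.ShortExact → ∀ j, vanishingFrom lvl G (lvl j + 1) S.X₁ →
    Function.Surjective ((G j).map S.g)
  stable : ∀ (m : ℕ) (X : A) (Q : ℕ → A) (g : ∀ n, X ⟶ Q n),
    (∀ n, ∃ h : Q n ⟶ Q (n + 1), g (n + 1) = g n ≫ h) →
    ∃ n₀, ∀ n ≥ n₀, ∀ j, lvl j = m → ∀ y : (G j).obj X,
      (G j).map (g n) y = 0 → (G j).map (g n₀) y = 0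

namespace IsNoetherianFamily

variable {J : Type w'} {lvl : J → ℕ} {G : J → A ⥤ AddCommGrpCat.{w}} (hG : IsNoetherianFamily lvl G)

include hG

theorem vanishingFrom_of_mono {m : ℕ} {X Y : A} (f : X ⟶ Y) [Mono f]
    (hY : vanishingFrom lvl G m Y) : vanishingFrom lvl G m X := fun j hj x => by
  have hf : (ShortComplex.mk f (cokernel.π f) (cokernel.condition f)).ShortExact :=
    { exact := ShortComplex.exact_of_g_is_cokernel _ (cokernelIsCokernel f) }
  refine hG.injective _ hf j ?_
  rw [map_zero]
  exact hY j hj _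

variable [∀ j, (G j).PreservesZeroMorphisms]

theorem vanishingFrom_kernel_of_stable {m : ℕ} {X Y Z : A} (a : X ⟶ Y) (b : Y ⟶ Z) [Epi a] [Epi b]
    (ha : vanishingFrom lvl G (m + 1) (kernel a))
    (hab : vanishingFrom lvl G (m + 1) (kernel (a ≫ b)))
    (hst : ∀ j, lvl j = m → ∀ y : (G j).obj X, (G j).map (a ≫ b) y = 0 → (G j).map a y = 0) :
    vanishingFrom lvl G m (kernel b) := fun j hj x => by
  obtain ⟨z, rfl⟩ := hG.surjective _ (kernelCompSequence_shortExact a b) j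
    (vanishingFrom_mono (by lia) _ ha) x
  obtain hj | hj := hj.lt_or_eq
  · rw [hab j hj z, map_zero]
  · refine hG.injective _ (kernel_shortExact b) j ?_
    have hz : (G j).map (a ≫ b) ((G j).map (kernel.ι (a ≫ b)) z) = 0 := by
      rw [map_map_apply (G j) (kernel.condition (a ≫ b)), Functor.map_zero]
      rfl
    rw [map_zero, map_map_apply (G j) (kernel.lift_ι b _ _), ← map_map_apply (G j) rfl]
    exact hst j hj.symm _ hz

theorem exists_vanishingFrom_kernel (Q : ℕ ⥤ A) (hQ : ∀ {n n' : ℕ} (f : n ⟶ n'), Epi (Q.map f))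
    {m M : ℕ} (hmM : m ≤ M) (hM : vanishingFrom lvl G M (Q.obj 0)) :
    ∃ n₀ : ℕ, ∀ (n : ℕ) (f : n₀ ⟶ n), vanishingFrom lvl G m (kernel (Q.map f)) := by
  induction hmM using Nat.decreasingInduction with
  | self => exact ⟨0, fun n f => hG.vanishingFrom_of_mono (kernel.ι (Q.map f)) hM⟩
  | of_succ m _ ih =>
    obtain ⟨n₀, hn₀⟩ := ih
    obtain ⟨n₁, hn₁⟩ := hG.stable m (Q.obj n₀) (fun i => Q.obj (n₀ + i))
      (fun i => Q.map (homOfLE (Nat.le_add_right n₀ i)))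
      (fun i => ⟨Q.map (homOfLE (by lia)), by rw [← Q.map_comp]; rfl⟩)
    refine ⟨n₀ + n₁, fun n f => ?_⟩
    obtain ⟨i, rfl⟩ := Nat.exists_eq_add_of_le ((Nat.le_add_right n₀ n₁).trans (leOfHom f))
    have := hQ f
    have : Epi (Q.map (homOfLE (Nat.le_add_right n₀ n₁))) := hQ _
    have hcomp : Q.map (homOfLE (Nat.le_add_right n₀ n₁)) ≫ Q.map f =
        Q.map (homOfLE (Nat.le_add_right n₀ i)) := by
      rw [← Q.map_comp]
      rfl
    refine hG.vanishingFrom_kernel_of_stable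
      (Q.map (homOfLE (Nat.le_add_right n₀ n₁))) (Q.map f) (hn₀ _ _) ?_ fun j hj y hy => ?_
    · rw [hcomp]
      exact hn₀ _ _
    · rw [hcomp] at hy
      exact hn₁ i (by have := leOfHom f; lia) j hj y hy

theorem isNoetherianObject (X : A) : IsNoetherianObject X := by
  rw [isNoetherianObject_iff_monotone_chain_condition]
  intro f
  let Q : ℕ ⥤ A :=
    { obj := fun n => cokernel (f n).arrow
      map := fun {n n'} h => cokernel.desc _ (cokernel.π (f n').arrow) (by
        rw [← Subobject.ofLE_arrow (f.monotone (leOfHom h)), Category.assoc,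
          cokernel.condition, comp_zero])
      map_id := fun n => by ext; simp
      map_comp := fun h h' => by ext; simp }
  have hπ {n n' : ℕ} (h : n ⟶ n') : cokernel.π (f n).arrow ≫ Q.map h = cokernel.π (f n').arrow :=
    cokernel.π_desc _ _ _
  obtain ⟨M, hM⟩ := hG.exists_vanishingFrom (Q.obj 0)
  obtain ⟨n₀, hn₀⟩ := hG.exists_vanishingFrom_kernel Q (fun h => epi_of_epi_fac (hπ h))
    (Nat.zero_le M) hM
  refine ⟨n₀, fun n hn => le_antisymm (f.monotone hn) ?_⟩
  have : Mono (Q.map (homOfLE hn)) :=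
    Preadditive.mono_of_isZero_kernel _ (hG.isZero _ (hn₀ n (homOfLE hn)))
  have h₀ : (f n).arrow ≫ cokernel.π (f n₀).arrow = 0 := by
    rw [← cancel_mono (Q.map (homOfLE hn)), Category.assoc, hπ, cokernel.condition, zero_comp]
  exact Subobject.le_of_comm (Abelian.monoLift (f n₀).arrow _ h₀) (Abelian.monoLift_comp _ _ _)

end IsNoetherianFamily

end NoetherianFamily

section Levels

variable {C : Type u} [Category.{v} C] [Preadditive C] [HasZeroObject C] [HasShift C ℤ]
  [∀ n : ℤ, (shiftFunctor C n).Additive] [Pretriangulated C] {J : Type w'}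

/-- The members of level `m` of a family of objects. -/
def ofLevel (lvl : J → ℕ) (N : J → C) (m : ℕ) : ObjectProperty C :=
  fun X => ∃ j, lvl j = m ∧ X = N j

variable {lvl : J → ℕ} {N D : J → C}

theorem mem_belowLevel_of_leftOrthogonal_ofLevel [IsTriangulated C] {m : ℕ}
    (hN : ofLevel lvl N m ≤ (belowLevel lvl N m).rightOrthogonal) {X : C}
    (hX : belowLevel lvl N (m + 1) X)
    (hXN : (triClosure (ofLevel lvl N m)).leftOrthogonal X) : belowLevel lvl N m X := by
  have hN' : triClosure (ofLevel lvl N m) ≤ (belowLevel lvl N m).rightOrthogonal :=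
    triClosure_le hN
  have := extensionProduct_isTriangulatedClosed₂ (P := belowLevel lvl N m)
    (extensionProduct_swap fun Y hY => le_shift _ 1 _ (hN' Y hY))
  have hle : belowLevel lvl N (m + 1) ≤ belowLevel lvl N m ∗ triClosure (ofLevel lvl N m) := by
    refine triClosure_le_of_shift ?_
    rintro _ ⟨j, hj, rfl⟩ n
    obtain hj | hj := Nat.lt_succ_iff_lt_or_eq.1 hj
    · exact le_extensionProduct_left _ _ (le_shift _ n _ (mem_belowLevel hj))
    · exact le_extensionProduct_right _ _
        (triClosure.shift _ n (triClosure.of _ ⟨j, hj, rfl⟩))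
  exact left_of_extensionProduct
    (fun A hA B f hB => hN' B hB f (le_shift _ 1 _ hA)) hXN (hle X hX)

namespace IsDualPair

variable (hp : IsDualPair lvl N D)

include hp

theorem mem_belowLevel_of_rightOrthogonal_ofLevel [IsTriangulated C] {m : ℕ} {X : C}
    (hX : belowLevel lvl N (m + 1) X)
    (hXD : (triClosure (ofLevel lvl D m)).rightOrthogonal X) : belowLevel lvl N m X := by
  have hD : triClosure (ofLevel lvl D m) ≤ (belowLevel lvl N m).leftOrthogonal := by
    refine triClosure_le ?_
    rintro _ ⟨j, hj, rfl⟩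
    exact hp.dual_mem_leftOrthogonal hj.ge
  have := extensionProduct_isTriangulatedClosed₂ (P := triClosure (ofLevel lvl D m))
    (extensionProduct_swap (P := belowLevel lvl N m) fun Y hY Z f hZ =>
      hD Z hZ f (le_shift _ 1 _ hY))
  have hle : belowLevel lvl N (m + 1) ≤ triClosure (ofLevel lvl D m) ∗ belowLevel lvl N m := by
    refine triClosure_le_of_shift ?_
    rintro _ ⟨j, hj, rfl⟩ n
    obtain hj | rfl := Nat.lt_succ_iff_lt_or_eq.1 hj
    · exact le_extensionProduct_right _ _ (le_shift _ n _ (mem_belowLevel hj))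
    · obtain ⟨c, Z, g, h, hT, hZ⟩ := hp.exists_comparison j
      exact extensionProduct_of_distTriang _ (Triangle.shift_distinguished _ hT n)
        (triClosure.shift _ n (triClosure.of _ ⟨j, rfl, rfl⟩)) (le_shift _ n _ hZ)
  exact right_of_extensionProduct
    (fun B hB A f hA => hD A hA f (le_shift _ (-1) _ hB)) hXD (hle X hX)

theorem hom_dual_dual {i j : J} (hij : lvl i ≤ lvl j) {n : ℤ} (hn : n ≠ 0)
    (f : D j ⟶ (D i)⟦n⟧) : f = 0 := by
  obtain ⟨c, Z, g, h, hT, hZ⟩ := hp.exists_comparison i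
  refine eq_zero_of_comp_mor₁_eq_zero _ (Triangle.shift_distinguished _ hT n)
    (hp.hom_dual_exc (fun h => hn h.2) _) fun y => ?_
  exact hp.dual_mem_leftOrthogonal hij y (le_shift _ (-1) _ (le_shift _ n _ hZ))

theorem hom_dual_dualLE {j : J} {s : Set J} (hs : ∀ i ∈ s, lvl i ≤ lvl j) {X : C}
    (hX : dualLE D s (-1) X) (f : D j ⟶ X) : f = 0 := by
  have hle : dualLE D s (-1) ≤ rightOrthogonal (fun Z => Z = D j) := by
    refine extClosure_le ?_
    rintro X ⟨i, hi, n, hn, ⟨e⟩⟩ _ f rfl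
    exact hom_eq_zero_of_iso (Iso.refl _) e (hp.hom_dual_dual (hs i hi) (by lia)) f
  exact hle X hX f rfl

theorem hom_excGE_exc (hN : ∀ j B, endCone (N j) B → IsZero B) {j : J} {s : Set J}
    (hs : ∀ i ∈ s, lvl i ≤ lvl j) {X : C} (hX : excGE N s 1 X) (f : X ⟶ N j) : f = 0 := by
  have hle : excGE N s 1 ≤ leftOrthogonal (fun Z => Z = N j) := by
    refine extClosure_le ?_
    rintro X ⟨i, hi, n, hn, B, hB, ⟨e⟩⟩ _ f rfl
    obtain rfl | hB := hB
    · exact hom_eq_zero_of_iso e ((shiftFunctorZero C ℤ).symm.app (N j))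
        (hom_shift_eq_zero (c := -n) (by simp) fun f =>
          hp.hom_eq_zero i j _ f (hs i hi) (by lia)) f
    · exact (((shiftFunctor C n).map_isZero (hN i B hB)).of_iso e).eq_of_src _ _
  exact hle X hX f rfl

variable [IsTriangulated C]

theorem dualLE_of_belowLevel {m : ℕ} {X : C} (hX : dualLE D Set.univ 0 X)
    (hXm : belowLevel lvl N m X) : dualLE D {j | lvl j < m} 0 X :=
  left_of_extensionProduct
    (fun _ hA _ f hB => hp.hom_dualLE_excGE (by lia) (dualLE_shift (n' := -1) (by lia) hA) hB f)
    (fun _ f hB => hp.hom_dualLE_excGE zero_lt_one hX hB f) (hp.belowLevel_le_truncation m X hXm)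

theorem excGE_of_belowLevel {m : ℕ} {X : C} (hX : excGE N Set.univ 1 X)
    (hXm : belowLevel lvl N m X) : excGE N {j | lvl j < m} 1 X :=
  right_of_extensionProduct
    (fun _ hB _ f hA => hp.hom_dualLE_excGE (by lia) hA (excGE_shift (n' := 2) (by lia) hB) f)
    (fun _ f hA => hp.hom_dualLE_excGE zero_lt_one hA hX f) (hp.belowLevel_le_truncation m X hXm)

theorem hom_dual_shift_eq_zero {m : ℕ} {X : C} (hX : dualLE D Set.univ 0 X)
    (hXm : belowLevel lvl N m X) {j : J} (hj : m ≤ lvl j + 1) {n : ℤ} (hn : 0 < n)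
    (f : D j ⟶ X⟦n⟧) : f = 0 := by
  have hs : ∀ i ∈ {j | lvl j < m}, lvl i ≤ lvl j := fun i hi => by
    rw [Set.mem_ofPred_eq] at hi
    lia
  have hXn : dualLE D {j | lvl j < m} (-n) (X⟦n⟧) :=
    dualLE_shift (by lia) (hp.dualLE_of_belowLevel hX hXm)
  exact hp.hom_dual_dualLE hs (dualLE_mono subset_rfl (by lia) _ hXn) f

theorem hom_exc_shift_eq_zero (hN : ∀ j B, endCone (N j) B → IsZero B) {m : ℕ} {X : C}
    (hX : excGE N Set.univ 0 X) (hXm : belowLevel lvl N m X) {j : J} (hj : m ≤ lvl j + 1) {n : ℤ}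
    (hn : n < 0) (f : X⟦n⟧ ⟶ N j) : f = 0 := by
  have hs : ∀ i ∈ {j | lvl j < m}, lvl i ≤ lvl j := fun i hi => by
    rw [Set.mem_ofPred_eq] at hi
    lia
  have hXn : excGE N Set.univ (-n) (X⟦n⟧) := excGE_shift (by lia) hX
  exact hp.hom_excGE_exc hN hs (hp.excGE_of_belowLevel (excGE_mono subset_rfl (by lia) _ hXn)
    (le_shift _ n _ hXm)) f

theorem belowLevel_of_hom_dual_eq_zero {m : ℕ} {X : C} (hle : dualLE D Set.univ 0 X)
    (hge : excGE N Set.univ 0 X) (h : ∀ j, m ≤ lvl j → ∀ f : D j ⟶ X, f = 0) :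
    belowLevel lvl N m X := by
  obtain ⟨M, hM⟩ := hp.generates X
  refine Nat.decreasingInduction' (P := fun k => belowLevel lvl N k X) (fun k _ hk hX => ?_)
    (le_max_left m M) (belowLevel_mono (le_max_right m M) X hM)
  refine hp.mem_belowLevel_of_rightOrthogonal_ofLevel hX (rightOrthogonal_triClosure ?_)
  rintro _ ⟨j, rfl, rfl⟩ n f
  obtain hn | rfl | hn := lt_trichotomy n 0
  · exact hp.hom_dualLE_excGE (b := -n) (by lia) (extClosure.of _ (dualGen_self (Set.mem_univ j)))
      (excGE_shift (by lia) hge) f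
  · exact hom_eq_zero_of_iso (Iso.refl _) ((shiftFunctorZero C ℤ).app X) (h j hk) f
  · exact hp.hom_dual_shift_eq_zero hle hX le_rfl hn f

theorem belowLevel_of_hom_exc_eq_zero (hN : ∀ j B, endCone (N j) B → IsZero B) {m : ℕ} {X : C}
    (hle : dualLE D Set.univ 0 X) (hge : excGE N Set.univ 0 X)
    (h : ∀ j, m ≤ lvl j → ∀ f : X ⟶ N j, f = 0) : belowLevel lvl N m X := by
  obtain ⟨M, hM⟩ := hp.generates X
  refine Nat.decreasingInduction' (P := fun k => belowLevel lvl N k X) (fun k _ hk hX => ?_)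
    (le_max_left m M) (belowLevel_mono (le_max_right m M) X hM)
  refine mem_belowLevel_of_leftOrthogonal_ofLevel ?_ hX (leftOrthogonal_triClosure ?_)
  · rintro _ ⟨j, hj, rfl⟩
    exact hp.mem_rightOrthogonal hj.ge
  rintro _ ⟨j, rfl, rfl⟩ n f
  obtain hn | rfl | hn := lt_trichotomy n 0
  · exact hp.hom_dualLE_excGE (b := -n) (by lia) hle
      (excGE_shift (by lia) (extClosure.of _ (excGen_self (Set.mem_univ j)))) f
  · exact hom_eq_zero_of_iso (Iso.refl _) ((shiftFunctorZero C ℤ).app (N j)) (h j hk) f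
  · apply (shiftFunctor C (-n)).map_injective
    rw [Functor.map_zero]
    exact hom_eq_zero_of_iso (Iso.refl _) ((shiftEquiv C n).unitIso.symm.app (N j))
      (hp.hom_exc_shift_eq_zero hN hge hX le_rfl (by lia)) _

end IsDualPair

end Levels

section ChainConditions

/-- For every sequence of morphisms `g n : X ⟶ Q n`, each factoring through the preceding one, the
subgroups of `Hom(W, X)` killed by `g n` become stationary, simultaneously for all `W` in `P`. -/
def HomKernelsStabilize {C : Type u} [Category.{v} C] [HasZeroMorphisms C]
    (P : ObjectProperty C) : Prop :=
  ∀ (X : C) (Q : ℕ → C) (g : ∀ n, X ⟶ Q n),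
    (∀ n, ∃ h : Q n ⟶ Q (n + 1), g (n + 1) = g n ≫ h) →
    ∃ n₀, ∀ n ≥ n₀, ∀ W, P W → ∀ y : W ⟶ X, y ≫ g n = 0 → y ≫ g n₀ = 0

variable {C : Type u} [Category.{v} C] [Preadditive C] [HasZeroObject C] [HasShift C ℤ]
  [∀ n : ℤ, (shiftFunctor C n).Additive] [Pretriangulated C] [IsTriangulated C] {J : Type w'}
  {lvl : J → ℕ} {N D : J → C}

namespace IsDualPair

attribute [local instance] heartAbelian

variable (hp : IsDualPair lvl N D)

theorem heart_isZero {X : hp.tStructure.heart.FullSubcategory}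
    (hX : belowLevel lvl N 0 X.obj) : IsZero X := by
  rw [IsZero.iff_id_eq_zero]
  ext
  exact (isZero_of_belowLevel_zero hX).eq_of_src _ _

/-- The functor `Hom(D j, -)` on the heart. -/
noncomputable def dualFunctor (j : J) :
    hp.tStructure.heart.FullSubcategory ⥤ AddCommGrpCat.{v} :=
  hp.tStructure.heart.ι ⋙ preadditiveCoyoneda.obj (.op (D j))

instance (j : J) : (hp.dualFunctor j).PreservesZeroMorphisms := by
  unfold dualFunctor
  infer_instance

theorem belowLevel_of_vanishingFrom_dualFunctor {m : ℕ}
    {X : hp.tStructure.heart.FullSubcategory} (hX : vanishingFrom lvl hp.dualFunctor m X) :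
    belowLevel lvl N m X.obj :=
  hp.belowLevel_of_hom_dual_eq_zero X.property.1 X.property.2 hX

theorem isNoetherianFamily_dualFunctor (hD : ∀ m, HomKernelsStabilize (ofLevel lvl D m)) :
    IsNoetherianFamily lvl hp.dualFunctor where
  exists_vanishingFrom X := by
    obtain ⟨m, hm⟩ := hp.generates X.obj
    exact ⟨m, fun j hj x => hp.dual_mem_leftOrthogonal hj x hm⟩
  isZero X hX := hp.heart_isZero (hp.belowLevel_of_vanishingFrom_dualFunctor hX)
  injective S hS j := by
    obtain ⟨δ, hT⟩ := heart_exists_distTriang_of_shortExact _ S hS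
    refine (injective_iff_map_eq_zero ((hp.dualFunctor j).map S.f).hom).2 fun x hx => ?_
    exact eq_zero_of_comp_mor₁_eq_zero _ hT hx
      (hp.hom_dualLE_excGE zero_lt_one (extClosure.of _ (dualGen_self (Set.mem_univ j)))
        (excGE_shift (by lia) S.X₃.property.2))
  surjective S hS j hX x := by
    obtain ⟨δ, hT⟩ := heart_exists_distTriang_of_shortExact _ S hS
    obtain ⟨y, hy⟩ := Triangle.coyoneda_exact₃ _ hT x
      (hp.hom_dual_shift_eq_zero S.X₁.property.1 (hp.belowLevel_of_vanishingFrom_dualFunctor hX)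
        le_rfl zero_lt_one _)
    exact ⟨y, hy.symm⟩
  stable m X Q g hg := by
    obtain ⟨n₀, h⟩ := hD m X.obj (fun n => (Q n).obj) (fun n => (g n).hom) fun n => by
      obtain ⟨h, hh⟩ := hg n
      exact ⟨h.hom, congrArg (fun φ => φ.hom) hh⟩
    exact ⟨n₀, fun n hn j hj => h n hn (D j) ⟨j, hj, rfl⟩⟩

theorem isNoetherianObject (hD : ∀ m, HomKernelsStabilize (ofLevel lvl D m))
    (X : hp.tStructure.heart.FullSubcategory) : IsNoetherianObject X :=
  (hp.isNoetherianFamily_dualFunctor hD).isNoetherianObject X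

/-- The functor `Hom(-, N j)` on the heart. -/
noncomputable def excFunctor (j : J) :
    hp.tStructure.heart.FullSubcategoryᵒᵖ ⥤ AddCommGrpCat.{v} :=
  hp.tStructure.heart.ι.op ⋙ preadditiveYoneda.obj (N j)

instance (j : J) : (hp.excFunctor j).PreservesZeroMorphisms := by
  unfold excFunctor
  infer_instance

theorem belowLevel_of_vanishingFrom_excFunctor (hN : ∀ j B, endCone (N j) B → IsZero B) {m : ℕ}
    {X : hp.tStructure.heart.FullSubcategoryᵒᵖ} (hX : vanishingFrom lvl hp.excFunctor m X) :
    belowLevel lvl N m X.unop.obj :=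
  hp.belowLevel_of_hom_exc_eq_zero hN X.unop.property.1 X.unop.property.2 hX

theorem isNoetherianFamily_excFunctor (hN : ∀ j B, endCone (N j) B → IsZero B)
    (hN' : ∀ m, HomKernelsStabilize (ofLevel lvl N m).op) :
    IsNoetherianFamily lvl hp.excFunctor where
  exists_vanishingFrom X := by
    obtain ⟨m, hm⟩ := hp.generates X.unop.obj
    exact ⟨m, fun j hj x => hp.mem_rightOrthogonal hj x hm⟩
  isZero X hX := (hp.heart_isZero (hp.belowLevel_of_vanishingFrom_excFunctor hN hX)).op
  injective S hS j := by
    obtain ⟨δ, hT⟩ := heart_exists_distTriang_of_shortExact _ S.unop hS.unop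
    refine (injective_iff_map_eq_zero ((hp.excFunctor j).map S.f).hom).2 fun x hx => ?_
    obtain ⟨y, hy⟩ := Triangle.yoneda_exact₃ _ hT x hx
    rw [hp.hom_dualLE_excGE neg_one_lt_zero (dualLE_shift (by lia) S.X₃.unop.property.1)
      (extClosure.of _ (excGen_self (Set.mem_univ j))) y] at hy
    exact hy.trans comp_zero
  surjective S hS j hX x := by
    obtain ⟨δ, hT⟩ := heart_exists_distTriang_of_shortExact _ S.unop hS.unop
    obtain ⟨y, hy⟩ := Triangle.yoneda_exact₂ _ (inv_rot_of_distTriang _ hT) x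
      (hp.hom_exc_shift_eq_zero hN S.X₁.unop.property.2
        (hp.belowLevel_of_vanishingFrom_excFunctor hN hX) le_rfl neg_one_lt_zero _)
    exact ⟨y, hy.symm⟩
  stable m X Q g hg := by
    obtain ⟨n₀, h⟩ := hN' m (.op X.unop.obj) (fun n => .op (Q n).unop.obj)
      (fun n => (g n).unop.hom.op) fun n => by
        obtain ⟨h, hh⟩ := hg n
        exact ⟨h.unop.hom.op, congrArg (fun φ => φ.unop.hom.op) hh⟩
    exact ⟨n₀, fun n hn j hj y hy =>
      congrArg Quiver.Hom.unop (h n hn (.op (N j)) ⟨j, hj, rfl⟩ y.op (congrArg Quiver.Hom.op hy))⟩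

theorem isArtinianObject (hN : ∀ j B, endCone (N j) B → IsZero B)
    (hN' : ∀ m, HomKernelsStabilize (ofLevel lvl N m).op)
    (X : hp.tStructure.heart.FullSubcategory) : IsArtinianObject X := by
  have := (hp.isNoetherianFamily_excFunctor hN hN').isNoetherianObject (.op X)
  have hX : WellFoundedLT (Subobject (Opposite.op X))ᵒᵈ := inferInstance
  exact ⟨(Abelian.subobjectIsoSubobjectOp X).toOrderEmbedding.wellFoundedLT⟩

end IsDualPair

end ChainConditions

section TwistPowers

variable {C : Type u} [Category.{v} C]

theorem nonempty_pow_succ_functor_iso (F : C ≌ C) (k : ℤ) :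
    Nonempty ((F ^ (k + 1)).functor ≅ F.functor ⋙ (F ^ k).functor) := by
  match k with
  | Int.ofNat 0 => exact ⟨(Functor.rightUnitor _).symm⟩
  | Int.ofNat (n + 1) => exact ⟨Iso.refl _⟩
  | Int.negSucc 0 => exact ⟨F.unitIso⟩
  | Int.negSucc (n + 1) =>
    exact ⟨(Functor.leftUnitor _).symm ≪≫ Functor.isoWhiskerRight F.unitIso _ ≪≫
      Functor.associator _ _ _⟩

theorem nonempty_iso_of_functor_comp_iso (F : C ≌ C) {G H : C ⥤ C}
    (e : F.functor ⋙ G ≅ F.functor ⋙ H) : Nonempty (G ≅ H) :=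
  ⟨(Functor.leftUnitor _).symm ≪≫ Functor.isoWhiskerRight F.counitIso.symm _ ≪≫
    Functor.associator _ _ _ ≪≫ Functor.isoWhiskerLeft _ e ≪≫ (Functor.associator _ _ _).symm ≪≫
    Functor.isoWhiskerRight F.counitIso _ ≪≫ Functor.leftUnitor _⟩

theorem nonempty_pow_add_functor_iso (F : C ≌ C) (k l : ℤ) :
    Nonempty ((F ^ k).functor ⋙ (F ^ l).functor ≅ (F ^ (k + l)).functor) := by
  induction k using Int.induction_on with
  | zero => rw [zero_add]; exact ⟨Functor.leftUnitor _⟩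
  | succ n ih =>
    obtain ⟨e⟩ := ih
    obtain ⟨e₁⟩ := nonempty_pow_succ_functor_iso F n
    obtain ⟨e₂⟩ := nonempty_pow_succ_functor_iso F (n + l)
    rw [show (n : ℤ) + 1 + l = n + l + 1 by ring]
    exact ⟨Functor.isoWhiskerRight e₁ _ ≪≫ Functor.associator _ _ _ ≪≫
      Functor.isoWhiskerLeft _ e ≪≫ e₂.symm⟩
  | pred n ih =>
    obtain ⟨e⟩ := ih
    obtain ⟨e₁⟩ := nonempty_pow_succ_functor_iso F (-n - 1)
    obtain ⟨e₂⟩ := nonempty_pow_succ_functor_iso F (-n - 1 + l)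
    rw [show -(n : ℤ) - 1 + 1 = -n by ring] at e₁
    rw [show -(n : ℤ) - 1 + l + 1 = -n + l by ring] at e₂
    exact nonempty_iso_of_functor_comp_iso F
      ((Functor.associator _ _ _).symm ≪≫ Functor.isoWhiskerRight e₁.symm _ ≪≫ e ≪≫ e₂)

variable [Preadditive C] [HasZeroObject C] [HasShift C ℤ]
  [∀ n : ℤ, (shiftFunctor C n).Additive] [Pretriangulated C]

theorem powNat_functor_isTriangulated (F : C ≌ C) [F.functor.CommShift ℤ]
    [F.functor.IsTriangulated] :
    ∀ n : ℕ, ∃ _ : (F.powNat n).functor.CommShift ℤ, (F.powNat n).functor.IsTriangulated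
  | 0 => ⟨inferInstanceAs ((𝟭 C).CommShift ℤ), inferInstanceAs ((𝟭 C).IsTriangulated)⟩
  | 1 => ⟨inferInstanceAs (F.functor.CommShift ℤ), inferInstanceAs (F.functor.IsTriangulated)⟩
  | n + 2 => by
    obtain ⟨_, _⟩ := powNat_functor_isTriangulated F (n + 1)
    exact ⟨inferInstanceAs ((F.functor ⋙ (F.powNat (n + 1)).functor).CommShift ℤ),
      inferInstanceAs ((F.functor ⋙ (F.powNat (n + 1)).functor).IsTriangulated)⟩

theorem pow_functor_isTriangulated (F : C ≌ C) [F.functor.CommShift ℤ]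
    [F.functor.IsTriangulated] (k : ℤ) :
    ∃ _ : (F ^ k).functor.CommShift ℤ, (F ^ k).functor.IsTriangulated := by
  match k with
  | Int.ofNat n => exact powNat_functor_isTriangulated F n
  | Int.negSucc n =>
    let := F.commShiftInverse ℤ
    have := F.commShift_of_functor ℤ
    have : F.inverse.IsTriangulated := F.toAdjunction.isTriangulated_rightAdjoint
    exact powNat_functor_isTriangulated F.symm (n + 1)

variable (F : C ≌ C) [F.functor.CommShift ℤ] [F.functor.IsTriangulated]

theorem nonempty_twist_shift_iso (k n : ℤ) (X : C) :
    Nonempty (twist F k (X⟦n⟧) ≅ (twist F k X)⟦n⟧) := by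
  obtain ⟨_, _⟩ := pow_functor_isTriangulated F k
  exact ⟨((F ^ k).functor.commShiftIso n).app X⟩

theorem twist_distTriang (k : ℤ) {X Y Z : C} {f : X ⟶ Y} {g : Y ⟶ Z} {h : Z ⟶ X⟦(1 : ℤ)⟧}
    (hT : Triangle.mk f g h ∈ distTriang C) :
    ∃ h' : twist F k Z ⟶ (twist F k X)⟦(1 : ℤ)⟧,
      Triangle.mk ((F ^ k).functor.map f) ((F ^ k).functor.map g) h' ∈ distTriang C := by
  obtain ⟨_, _⟩ := pow_functor_isTriangulated F k
  exact ⟨_, (F ^ k).functor.map_distinguished _ hT⟩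

theorem twist_hom_eq_zero {X Y : C} {k l n : ℤ}
    (h : ∀ f : X ⟶ twist F (l - k) (Y⟦n⟧), f = 0) (f : twist F k X ⟶ (twist F l Y)⟦n⟧) :
    f = 0 := by
  obtain ⟨e⟩ := nonempty_twist_shift_iso F l n Y
  obtain ⟨e'⟩ := nonempty_pow_add_functor_iso F (l - k) k
  rw [sub_add_cancel] at e'
  refine hom_eq_zero_of_iso (Iso.refl _) (e.symm ≪≫ e'.symm.app (Y⟦n⟧)) (fun f => ?_) f
  obtain ⟨f, rfl⟩ := (F ^ k).functor.map_surjective f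
  rw [h f, Functor.map_zero]

theorem extClosure_twist {P Q : ObjectProperty C} (k : ℤ)
    (h : ∀ X, P X → extClosure Q (twist F k X)) {X : C} (hX : extClosure P X) :
    extClosure Q (twist F k X) := by
  induction hX with
  | of X hX => exact h X hX
  | zero X hX => exact extClosure.zero _ ((F ^ k).functor.map_isZero hX)
  | ext T hT _ _ ih₁ ih₃ =>
    obtain ⟨h', hT'⟩ := twist_distTriang F k hT
    exact extClosure.ext _ hT' ih₁ ih₃

theorem triClosure_twist {P Q : ObjectProperty C} (k : ℤ)
    (h : ∀ X, P X → triClosure Q (twist F k X)) {X : C} (hX : triClosure P X) :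
    triClosure Q (twist F k X) := by
  induction hX with
  | of X hX => exact h X hX
  | zero X hX => exact triClosure.zero _ ((F ^ k).functor.map_isZero hX)
  | shift X n _ ih =>
    obtain ⟨e⟩ := nonempty_twist_shift_iso F k n X
    exact triClosure_of_iso _ e.symm (triClosure.shift _ n ih)
  | ext T hT _ _ ih₁ ih₃ =>
    obtain ⟨h', hT'⟩ := twist_distTriang F k hT
    exact triClosure.ext _ hT' ih₁ ih₃

end TwistPowers

section Twists

variable {C : Type u} [Category.{v} C] {I : Type w'}

/-- The family of all twists `X_i⟨k⟩` of the members of a family. -/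
abbrev twists (F : C ≌ C) (X : I → C) : I × ℤ → C := fun j => twist F j.2 (X j.1)

/-- A level function on a family, extended to its twists. -/
abbrev twistLevel (lvl : I → ℕ) : I × ℤ → ℕ := fun j => lvl j.1

variable [Preadditive C] [HasZeroObject C] [HasShift C ℤ]
  [∀ n : ℤ, (shiftFunctor C n).Additive] [Pretriangulated C] (F : C ≌ C)
  (lvl : I → ℕ) (nabla : I → C)

theorem generated_eq_belowLevel {m : ℕ} {s : Set I} (hs : ∀ i, i ∈ s ↔ lvl i < m) :
    generated F nabla s = belowLevel (twistLevel lvl) (twists F nabla) m := by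
  refine le_antisymm (triClosure_mono ?_) (triClosure_mono ?_)
  · rintro _ ⟨i, hi, k, rfl⟩
    exact ⟨(i, k), (hs i).1 hi, rfl⟩
  · rintro _ ⟨⟨i, k⟩, hi, rfl⟩
    exact ⟨i, (hs i).2 hi, k, rfl⟩

theorem exists_belowLevel_of_generated {X : C} (hX : generated F nabla Set.univ X) :
    ∃ m, belowLevel (twistLevel lvl) (twists F nabla) m X := by
  induction hX with
  | of X hX =>
    obtain ⟨i, -, k, rfl⟩ := hX
    exact ⟨lvl i + 1, triClosure.of _ ⟨(i, k), Nat.lt_succ_self _, rfl⟩⟩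
  | zero X hX => exact ⟨0, triClosure.zero X hX⟩
  | shift X n _ ih =>
    obtain ⟨m, hm⟩ := ih
    exact ⟨m, triClosure.shift X n hm⟩
  | ext T hT _ _ ih₁ ih₃ =>
    obtain ⟨m, hm⟩ := ih₁
    obtain ⟨m', hm'⟩ := ih₃
    exact ⟨max m m', triClosure.ext T hT (belowLevel_mono (le_max_left m m') _ hm)
      (belowLevel_mono (le_max_right m m') _ hm')⟩

variable [F.functor.CommShift ℤ] [F.functor.IsTriangulated]

theorem belowLevel_twist (k : ℤ) {m : ℕ} {X : C}
    (hX : belowLevel (twistLevel lvl) (twists F nabla) m X) :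
    belowLevel (twistLevel lvl) (twists F nabla) m (twist F k X) := by
  refine triClosure_twist F k ?_ hX
  rintro _ ⟨⟨i, l⟩, hj, rfl⟩
  obtain ⟨e⟩ := nonempty_pow_add_functor_iso F l k
  exact triClosure_of_iso _ (e.symm.app (nabla i)) (triClosure.of _ ⟨⟨i, l + k⟩, hj, rfl⟩)

end Twists

section Comparison

variable {C : Type u} [Category.{v} C] [Preadditive C] [HasZeroObject C] [HasShift C ℤ]
  [∀ n : ℤ, (shiftFunctor C n).Additive] [Pretriangulated C]

theorem exists_trW_leftOrthogonal_rightOrthogonal [IsTriangulated C] {A : ObjectProperty C}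
    [A.IsTriangulated] {X Y : C} (hX : A.leftOrthogonal X) (φ : A.trW.Q.obj X ≅ A.trW.Q.obj Y) :
    ∃ c : X ⟶ Y, A.rightOrthogonal.leftOrthogonal.trW c := by
  obtain ⟨c, hc⟩ := (leftOrthogonal.map_bijective_of_isTriangulated hX A.trW.Q Y).2 φ.hom
  obtain ⟨Z, g, h, hT⟩ := distinguished_cocone_triangle c
  have : IsIso (A.trW.Q.mapTriangle.obj (Triangle.mk c g h)).mor₁ := by
    change IsIso (A.trW.Q.map c)
    rw [hc]
    infer_instance
  have hZ : IsZero (A.trW.Q.obj Z) :=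
    Triangle.isZero₃_of_isIso₁ _ (A.trW.Q.map_distinguished _ hT) this
  exact ⟨c, trW.mk _ hT fun B f hB =>
    (rightOrthogonal.map_bijective_of_isTriangulated hB A.trW.Q Z).1 (hZ.eq_of_src _ _)⟩

variable (F : C ≌ C) [F.functor.CommShift ℤ] [F.functor.IsTriangulated]
  {I : Type w'} [LinearOrder I] {nabla delta : I → C}

theorem dual_mem_leftOrthogonal_generated (hdelta : IsDual F nabla delta) (i : I) :
    (generated F nabla (Set.Iio i)).leftOrthogonal (delta i) := by
  refine leftOrthogonal_triClosure ?_
  rintro _ ⟨j, hj, k, rfl⟩ n f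
  obtain ⟨e⟩ := nonempty_twist_shift_iso F k n (nabla j)
  exact hom_eq_zero_of_iso (Iso.refl _) e.symm (hdelta.hom_eq_zero j i hj n k) f

variable [IsTriangulated C]

theorem exists_comparison (hdelta : IsDual F nabla delta) (e : I ↪o ℕ)
    (hN : ∀ m, ofLevel (twistLevel e) (twists F nabla) m ≤
      (belowLevel (twistLevel e) (twists F nabla) m).rightOrthogonal) (i : I) :
    ∃ c : delta i ⟶ nabla i, (belowLevel (twistLevel e) (twists F nabla) (e i)).trW c := by
  have hIio : generated F nabla (Set.Iio i) = belowLevel (twistLevel e) (twists F nabla) (e i) :=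
    generated_eq_belowLevel F e nabla fun j => by simp
  have hIic : generated F nabla (Set.Iic i) =
      belowLevel (twistLevel e) (twists F nabla) (e i + 1) :=
    generated_eq_belowLevel F e nabla fun j => by simp
  obtain ⟨h, ⟨φ⟩⟩ := hdelta.quotient_iso i
  have hΔ : (TLT F nabla i).leftOrthogonal ⟨delta i, h⟩ := fun Y f hY => by
    ext
    exact dual_mem_leftOrthogonal_generated F hdelta i f.hom hY
  obtain ⟨c, Z, g, k, hT, hZ⟩ := exists_trW_leftOrthogonal_rightOrthogonal hΔ φ
  refine ⟨c.hom, Z.obj, g.hom, _, (generated F nabla (Set.Iic i)).ι.map_distinguished _ hT,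
    mem_belowLevel_of_leftOrthogonal_ofLevel (hN _) (hIic ▸ Z.property) fun Y f hY => ?_⟩
  have hYle : generated F nabla (Set.Iic i) Y := by
    rw [hIic]
    refine triClosure_mono ?_ Y hY
    rintro _ ⟨j, hj, rfl⟩
    exact ⟨j, by lia, rfl⟩
  have hYlt : (TLT F nabla i).rightOrthogonal ⟨Y, hYle⟩ := fun W a hW => by
    ext
    exact triClosure_le (hN (e i)) Y hY a.hom (hIio ▸ hW)
  exact congrArg (fun a => a.hom) (hZ (homMk (Y := ⟨Y, hYle⟩) f) hYlt)

end Comparison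

section Finiteness

open scoped DirectSum

theorem exists_forall_eq_of_finite_directSum {E : Type w} [CommRing E] [IsNoetherianRing E]
    {ι : Type w'} {M : ι → Type v} [∀ i, AddCommGroup (M i)] [∀ i, Module E (M i)]
    [Module.Finite E (⨁ i, M i)] (V : ∀ i, ℕ →o Submodule E (M i)) :
    ∃ n₀, ∀ n ≥ n₀, ∀ i, V i n₀ = V i n := by
  classical
  let U : ℕ →o Submodule E (⨁ i, M i) :=
    ⟨fun n => ⨅ i, (V i n).comap (DirectSum.component E ι M i),
      fun _ _ h => iInf_mono fun i => Submodule.comap_mono ((V i).monotone h)⟩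
  have lof_mem (i : ι) (n : ℕ) (x : M i) : DirectSum.lof E ι M i x ∈ U n ↔ x ∈ V i n := by
    change _ ∈ ⨅ i, (V i n).comap (DirectSum.component E ι M i) ↔ _
    simp only [Submodule.mem_iInf, Submodule.mem_comap]
    refine ⟨fun h => by simpa only [DirectSum.component.lof_self] using h i, fun h j => ?_⟩
    obtain rfl | hij := eq_or_ne i j
    · rwa [DirectSum.component.lof_self]
    · rw [DirectSum.component.of, dif_neg hij]
      exact zero_mem _
  obtain ⟨n₀, hn₀⟩ := monotone_stabilizes_iff_noetherian.2
    (inferInstanceAs (IsNoetherian E (⨁ i, M i))) U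
  refine ⟨n₀, fun n hn i => Submodule.ext fun x => ?_⟩
  rw [← lof_mem, ← lof_mem, hn₀ n hn]

variable {C : Type u} [Category.{v} C] [Preadditive C] {E : Type w} [CommRing E]
  [IsNoetherianRing E] [Linear E C] {F : C ≌ C} (hfin : GradedHomFinite E F)

include hfin

theorem homKernelsStabilize_twist (W : C) :
    HomKernelsStabilize (ofObj fun k : ℤ => twist F k W) := by
  intro X Q g hg
  have := hfin W X
  obtain ⟨n₀, hn₀⟩ := exists_forall_eq_of_finite_directSum fun k : ℤ =>
    ⟨fun n => LinearMap.ker (Linear.rightComp E W ((F ^ k).functor.map (g n))),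
      monotone_nat_of_le_succ fun n x (hx : x ≫ _ = 0) => by
        obtain ⟨h, hh⟩ := hg n
        change x ≫ _ = 0
        rw [hh, Functor.map_comp, reassoc_of% hx, zero_comp]⟩
  refine ⟨n₀, fun n hn => ?_⟩
  rintro _ ⟨k⟩ y
  obtain ⟨φ⟩ := nonempty_pow_add_functor_iso F k (-k)
  rw [add_neg_cancel] at φ
  let ψ : W ≅ twist F (-k) (twist F k W) := φ.symm.app W
  have hψ (n : ℕ) : (ψ.hom ≫ (F ^ (-k)).functor.map y) ≫ (F ^ (-k)).functor.map (g n) = 0 ↔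
      y ≫ g n = 0 := by
    rw [Category.assoc, ← Functor.map_comp, Preadditive.IsIso.comp_left_eq_zero,
      Functor.map_eq_zero_iff]
  rw [← hψ, ← hψ]
  exact (hn₀ n hn (-k)).ge (x := ψ.hom ≫ (F ^ (-k)).functor.map y)

theorem homKernelsStabilize_op_twist (W : C) :
    HomKernelsStabilize (ofObj fun k : ℤ => twist F k W).op := by
  rintro ⟨X⟩ Q g hg
  have := hfin X W
  obtain ⟨n₀, hn₀⟩ := exists_forall_eq_of_finite_directSum fun k : ℤ =>
    ⟨fun n => LinearMap.ker (Linear.leftComp E (twist F k W) (g n).unop),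
      monotone_nat_of_le_succ fun n x (hx : _ ≫ x = 0) => by
        obtain ⟨h, hh⟩ := hg n
        change _ ≫ x = 0
        rw [hh, unop_comp, Category.assoc, hx, comp_zero]⟩
  refine ⟨n₀, fun n hn => ?_⟩
  rintro ⟨_⟩ ⟨k⟩ y hy
  exact congrArg Quiver.Hom.op ((hn₀ n hn k).ge (x := y.unop) (congrArg Quiver.Hom.unop hy))

end Finiteness

section FinitenessOnLevels

variable {C : Type u} [Category.{v} C]

theorem HomKernelsStabilize.mono [HasZeroMorphisms C] {P Q : ObjectProperty C}
    (hQ : HomKernelsStabilize Q) (h : P ≤ Q) : HomKernelsStabilize P := fun X Y g hg =>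
  let ⟨n₀, hn₀⟩ := hQ X Y g hg
  ⟨n₀, fun n hn W hW => hn₀ n hn W (h W hW)⟩

variable [HasZeroObject C] {F : C ≌ C} {I : Type w'}

theorem exists_ofLevel_twists_le {lvl : I → ℕ} (hlvl : Function.Injective lvl) (X : I → C)
    (m : ℕ) : ∃ W, ofLevel (twistLevel lvl) (twists F X) m ≤ ofObj fun k : ℤ => twist F k W := by
  by_cases hm : ∃ i, lvl i = m
  · obtain ⟨i, rfl⟩ := hm
    refine ⟨X i, ?_⟩
    rintro _ ⟨⟨j, k⟩, hj, rfl⟩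
    obtain rfl := hlvl hj
    exact ofObj_apply _ k
  · exact ⟨0, fun _ ⟨j, hj, _⟩ => absurd ⟨j.1, hj⟩ hm⟩

variable [Preadditive C] {E : Type w} [CommRing E] [IsNoetherianRing E] [Linear E C]
  (hfin : GradedHomFinite E F) {lvl : I → ℕ} (hlvl : Function.Injective lvl) (X : I → C) (m : ℕ)

include hfin hlvl

theorem homKernelsStabilize_ofLevel_twists :
    HomKernelsStabilize (ofLevel (twistLevel lvl) (twists F X) m) :=
  let ⟨W, hW⟩ := exists_ofLevel_twists_le hlvl X m
  (homKernelsStabilize_twist hfin W).mono hW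

theorem homKernelsStabilize_op_ofLevel_twists :
    HomKernelsStabilize (ofLevel (twistLevel lvl) (twists F X) m).op :=
  let ⟨W, hW⟩ := exists_ofLevel_twists_le hlvl X m
  (homKernelsStabilize_op_twist hfin W).mono (op_monotone hW)

end FinitenessOnLevels

section ScalarEndomorphisms

variable {C : Type u} [Category.{v} C] [Preadditive C] {E : Type w} [CommRing E] [Linear E C]

theorem smul_id_comp (a : E) {X Y : C} (f : X ⟶ Y) : (a • 𝟙 X) ≫ f = a • f := by
  rw [Linear.smul_comp, Category.id_comp]

theorem isIso_smul_id {a : E} (ha : IsUnit a) (X : C) : IsIso (a • 𝟙 X) :=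
  (isUnit_iff_isIso _).1 (ha.map (algebraMap E (End X)))

variable {X : C} (hX : Function.Bijective (algebraMap E (End X)))

include hX

theorem exists_eq_smul_id (f : X ⟶ X) : ∃ a : E, f = a • 𝟙 X :=
  let ⟨a, ha⟩ := hX.2 f
  ⟨a, ha.symm⟩

theorem smul_id_eq_zero_iff {a : E} : a • 𝟙 X = 0 ↔ a = 0 :=
  map_eq_zero_iff (algebraMap E (End X)) hX.1

theorem eq_zero_or_eq_zero_of_end_comp_eq_zero [IsDomain E] {p q : X ⟶ X} (h : p ≫ q = 0) :
    p = 0 ∨ q = 0 := by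
  obtain ⟨a, rfl⟩ := exists_eq_smul_id hX p
  obtain ⟨b, rfl⟩ := exists_eq_smul_id hX q
  rw [smul_id_comp, smul_smul] at h
  simpa only [smul_id_eq_zero_iff hX, mul_eq_zero] using h

theorem exists_end_comp_eq_or_exists_end_comp_eq [PreValuationRing E] (p q : X ⟶ X) :
    (∃ v, p = v ≫ q) ∨ ∃ v, q = v ≫ p := by
  obtain ⟨a, rfl⟩ := exists_eq_smul_id hX p
  obtain ⟨b, rfl⟩ := exists_eq_smul_id hX q
  obtain ⟨c, rfl⟩ | ⟨c, rfl⟩ := ValuationRing.dvd_total a b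
  · exact Or.inr ⟨c • 𝟙 X, by rw [smul_id_comp, smul_smul, mul_comm]⟩
  · exact Or.inl ⟨c • 𝟙 X, by rw [smul_id_comp, smul_smul, mul_comm]⟩

theorem isIso_of_ne_zero_of_isField (hE : IsField E) {p : X ⟶ X} (hp : p ≠ 0) : IsIso p := by
  obtain ⟨a, rfl⟩ := exists_eq_smul_id hX p
  obtain ⟨b, hb⟩ := hE.mul_inv_cancel fun ha => hp ((smul_id_eq_zero_iff hX).2 ha)
  exact isIso_smul_id (.of_mul_eq_one b hb) X

end ScalarEndomorphisms

section ScalarCones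

variable {C : Type u} [Category.{v} C] [Preadditive C] [HasZeroObject C] [HasShift C ℤ]
  [∀ n : ℤ, (shiftFunctor C n).Additive] [Pretriangulated C] {E : Type w} [CommRing E]
  [Linear E C]

/-- The cones of multiplication by the scalar `a` on `X`. -/
def smulCone (a : E) (X : C) : ObjectProperty C :=
  fun B => ∃ (g : X ⟶ B) (h : B ⟶ X⟦(1 : ℤ)⟧), Triangle.mk (a • 𝟙 X) g h ∈ distTriang C

theorem isZero_of_smulCone {a : E} (ha : IsUnit a) {X B : C} (hB : smulCone a X B) :
    IsZero B := by
  obtain ⟨g, h, hT⟩ := hB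
  exact Triangle.isZero₃_of_isIso₁ _ hT (isIso_smul_id ha X)

theorem smulCone_le_endCone {X : C} (hX : Function.Bijective (algebraMap E (End X))) {a : E}
    (ha : a ≠ 0) : smulCone a X ≤ endCone X :=
  fun _ ⟨g, h, hT⟩ => ⟨a • 𝟙 X, g, h, (smul_id_eq_zero_iff hX).not.2 ha, hT⟩

theorem exists_smulCone_of_endCone {X B : C} (hX : Function.Bijective (algebraMap E (End X)))
    (hB : endCone X B) : ∃ a : E, a ≠ 0 ∧ smulCone a X B := by
  obtain ⟨p, g, h, hp, hT⟩ := hB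
  obtain ⟨a, rfl⟩ := exists_eq_smul_id hX p
  exact ⟨a, (smul_id_eq_zero_iff hX).not.1 hp, g, h, hT⟩

section IsTriangulated

variable [IsTriangulated C] (X : C)

theorem smulCone_mul_le (a b : E) : smulCone (a * b) X ≤ smulCone a X ∗ smulCone b X := by
  rintro B ⟨g, h, hT⟩
  obtain ⟨Y, g₁, h₁, hT₁⟩ := distinguished_cocone_triangle (a • 𝟙 X)
  obtain ⟨Z, g₂, h₂, hT₂⟩ := distinguished_cocone_triangle (b • 𝟙 X)
  exact extensionProduct_of_distTriang _
    (Triangulated.someOctahedron (by rw [smul_id_comp, smul_smul]) hT₁ hT₂ hT).mem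
    ⟨_, _, hT₁⟩ ⟨_, _, hT₂⟩

theorem smulCone_mul_le_extClosure {P : ObjectProperty C} {a b : E}
    (ha : smulCone a X ≤ extClosure P) (hb : smulCone b X ≤ extClosure P) :
    smulCone (a * b) X ≤ extClosure P :=
  (smulCone_mul_le X a b).trans (extensionProduct_le_of_isTriangulatedClosed₂ ha hb)

theorem smulCone_le_extClosure_of_associated_pow {a b : E} {r : ℕ} (h : Associated (a ^ r) b) :
    smulCone b X ≤ extClosure (smulCone a X) := by
  have hunit {u : E} (hu : IsUnit u) : smulCone u X ≤ extClosure (smulCone a X) :=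
    fun B hB => extClosure.zero B (isZero_of_smulCone hu hB)
  obtain ⟨u, rfl⟩ := h
  refine smulCone_mul_le_extClosure X ?_ (hunit u.isUnit)
  induction r with
  | zero => exact hunit (by rw [pow_zero]; exact isUnit_one)
  | succ r ih =>
    rw [pow_succ]
    exact smulCone_mul_le_extClosure X ih (le_extClosure _)

end IsTriangulated

end ScalarCones

section Reduction

variable {C : Type u} [Category.{v} C] [Preadditive C] [HasZeroObject C] [HasShift C ℤ]
  [∀ n : ℤ, (shiftFunctor C n).Additive] [Pretriangulated C] {E : Type w} [CommRing E]
  [Linear E C] {ϖ : E} {N B : C}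

theorem isReduction_iff_isZero (hE : IsField E) : IsReduction ϖ N B ↔ IsZero B := by
  simp only [IsReduction, hE, true_and, not_true_eq_false, false_and, or_false]

theorem isReduction_iff_smulCone (hE : ¬ IsField E) : IsReduction ϖ N B ↔ smulCone ϖ N B := by
  simp only [IsReduction, hE, false_and, not_false_eq_true, true_and, false_or, smulCone]

variable [IsLocalRing E]

theorem uniformizer_ne_zero (hϖ : IsLocalRing.maximalIdeal E = Ideal.span {ϖ})
    (hE : ¬ IsField E) : ϖ ≠ 0 := by
  rintro rfl
  exact hE (IsLocalRing.isField_iff_maximalIdeal_eq.2 (by rw [hϖ, Ideal.span_singleton_zero]))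

variable [IsDomain E] [IsPrincipalIdealRing E]

theorem exists_associated_pow_uniformizer (hϖ : IsLocalRing.maximalIdeal E = Ideal.span {ϖ})
    (hE : ¬ IsField E) {a : E} (ha : a ≠ 0) : ∃ r, Associated (ϖ ^ r) a := by
  have : IsDiscreteValuationRing E :=
    { not_a_field' := fun h => hE (IsLocalRing.isField_iff_maximalIdeal_eq.2 h) }
  obtain ⟨r, hr⟩ := IsDiscreteValuationRing.associated_pow_irreducible ha
    ((IsDiscreteValuationRing.irreducible_iff_uniformizer ϖ).2 hϖ)
  exact ⟨r, hr.symm⟩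

theorem extClosure_endCone_eq [IsTriangulated C]
    (hϖ : IsLocalRing.maximalIdeal E = Ideal.span {ϖ})
    (hN : Function.Bijective (algebraMap E (End N))) :
    extClosure (endCone N) = extClosure (IsReduction ϖ N) := by
  by_cases hE : IsField E
  · refine le_antisymm (extClosure_le fun B hB => ?_) (extClosure_le fun B hB => ?_)
    · exact extClosure.zero B (hB.isZero fun p hp => isIso_of_ne_zero_of_isField hN hE hp)
    · exact extClosure.zero B ((isReduction_iff_isZero hE).1 hB)
  · have hred : IsReduction ϖ N = smulCone ϖ N :=
      funext fun B => propext (isReduction_iff_smulCone hE)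
    rw [hred]
    refine le_antisymm (extClosure_le fun B hB => ?_)
      (extClosure_mono (smulCone_le_endCone hN (uniformizer_ne_zero hϖ hE)))
    obtain ⟨a, ha, hB⟩ := exists_smulCone_of_endCone hN hB
    obtain ⟨r, hr⟩ := exists_associated_pow_uniformizer hϖ hE ha
    exact smulCone_le_extClosure_of_associated_pow N hr B hB

end Reduction

section Twisted

variable {C : Type u} [Category.{v} C] [Preadditive C] [HasZeroObject C] [HasShift C ℤ]
  [∀ n : ℤ, (shiftFunctor C n).Additive] [Pretriangulated C]
  (F : C ≌ C) [F.functor.CommShift ℤ] [F.functor.IsTriangulated]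

theorem endCone_twist (k : ℤ) {X B : C} (hB : endCone X B) :
    endCone (twist F k X) (twist F k B) := by
  obtain ⟨p, g, h, hp, hT⟩ := hB
  obtain ⟨h', hT'⟩ := twist_distTriang F k hT
  exact ⟨_, _, h', ((F ^ k).functor.map_eq_zero_iff).not.2 hp, hT'⟩

theorem exists_iso_twist_of_endCone (k : ℤ) {X B : C} (hB : endCone (twist F k X) B) :
    ∃ B₀, endCone X B₀ ∧ Nonempty (twist F k B₀ ≅ B) := by
  obtain ⟨p, g, h, hp, hT⟩ := hB
  obtain ⟨p, rfl⟩ := (F ^ k).functor.map_surjective p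
  obtain ⟨B₀, g₀, h₀, hT₀⟩ := distinguished_cocone_triangle p
  obtain ⟨h', hT'⟩ := twist_distTriang F k hT₀
  exact ⟨B₀, ⟨p, g₀, h₀, ((F ^ k).functor.map_eq_zero_iff).not.1 hp, hT₀⟩,
    ⟨Triangle.π₃.mapIso (isoTriangleOfIso₁₂ _ _ hT' hT (Iso.refl _) (Iso.refl _)
      ((Category.comp_id _).trans (Category.id_comp _).symm))⟩⟩

theorem isZero_of_endCone_twist (k : ℤ) {X B : C} (hX : ∀ p : X ⟶ X, p ≠ 0 → IsIso p)
    (hB : endCone (twist F k X) B) : IsZero B := by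
  obtain ⟨B₀, hB₀, ⟨e⟩⟩ := exists_iso_twist_of_endCone F k hB
  exact ((F ^ k).functor.map_isZero (hB₀.isZero hX)).of_iso e.symm

variable {I : Type w'}

theorem extClosure_twist_shift {P Q : ObjectProperty C} {k n : ℤ}
    (h : ∀ X, P X → extClosure Q (twist F k (X⟦n⟧))) {X : C} (hX : extClosure P X) :
    extClosure Q (twist F k (X⟦n⟧)) := by
  have hX' : extClosure (fun Y => ∃ X, P X ∧ Y = X⟦n⟧) (X⟦n⟧) :=
    extClosure_shift n (fun X hX => extClosure.of _ ⟨X, hX, rfl⟩) hX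
  refine extClosure_twist F k ?_ hX'
  rintro _ ⟨X, hX, rfl⟩
  exact h X hX

theorem dualLE_twists_eq_tLE (delta : I → C) :
    dualLE (twists F delta) Set.univ 0 = tLE F delta := by
  unfold tLE
  refine le_antisymm (extClosure_le ?_) (extClosure_mono ?_)
  · rintro X ⟨⟨j, k⟩, -, n, hn, ⟨e⟩⟩
    obtain ⟨e'⟩ := nonempty_twist_shift_iso F k n (delta j)
    exact extClosure_of_iso _ (e' ≪≫ e.symm) (extClosure.of _ ⟨j, n, k, by lia, rfl⟩)
  · rintro _ ⟨j, n, k, hn, rfl⟩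
    exact ⟨(j, k), Set.mem_univ _, n, by lia, nonempty_twist_shift_iso F k n (delta j)⟩

variable {E : Type w} [CommRing E] [Linear E C] {nabla : I → C} {ϖ : E}

theorem excGE_twists_eq_tGE
    (h : ∀ i, extClosure (endCone (nabla i)) = extClosure (IsReduction ϖ (nabla i))) :
    excGE (twists F nabla) Set.univ 0 = tGE ϖ F nabla := by
  unfold tGE
  refine le_antisymm (extClosure_le ?_) (extClosure_le ?_)
  · rintro X ⟨⟨j, k⟩, -, n, hn, B, rfl | hB, ⟨e⟩⟩
    · obtain ⟨e'⟩ := nonempty_twist_shift_iso F k n (nabla j)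
      exact extClosure_of_iso _ (e' ≪≫ e.symm)
        (extClosure.of _ ⟨j, n, k, by lia, Or.inl rfl⟩)
    · obtain ⟨B₀, hB₀, ⟨e₀⟩⟩ := exists_iso_twist_of_endCone F k hB
      obtain ⟨e'⟩ := nonempty_twist_shift_iso F k n B₀
      have hB₀' : extClosure (IsReduction ϖ (nabla j)) B₀ := h j ▸ extClosure.of _ hB₀
      exact extClosure_of_iso _ (e' ≪≫ (shiftFunctor C n).mapIso e₀ ≪≫ e.symm)
        (extClosure_twist_shift F
          (fun B hB => extClosure.of _ ⟨j, n, k, by lia, Or.inr ⟨B, hB, rfl⟩⟩) hB₀')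
  · rintro _ ⟨j, n, k, hn, rfl | ⟨B, hB, rfl⟩⟩
    · exact extClosure.of _ ⟨(j, k), Set.mem_univ _, n, by lia, _, Or.inl rfl,
        nonempty_twist_shift_iso F k n (nabla j)⟩
    · have hB' : extClosure (endCone (nabla j)) B := h j ▸ extClosure.of _ hB
      exact extClosure_twist_shift F (fun B hB => extClosure.of _ ⟨(j, k), Set.mem_univ _, n,
        by lia, _, Or.inr (endCone_twist F k hB), nonempty_twist_shift_iso F k n B⟩) hB'

end Twisted

section ExceptionalSequence

variable {C : Type u} [Category.{v} C] [Preadditive C] [HasZeroObject C] [HasShift C ℤ]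
  [∀ n : ℤ, (shiftFunctor C n).Additive] [Pretriangulated C]
  {E : Type w} [CommRing E] [Linear E C]
  {F : C ≌ C} {I : Type w'} [LinearOrder I] {nabla delta : I → C}

theorem bijective_algebraMap_end_of_isExceptional (hnabla : IsExceptional E F nabla) (i : I) :
    Function.Bijective (algebraMap E (End (nabla i))) :=
  let ⟨φ⟩ := hnabla.end_equiv i
  bijective_algebraMap_of_linearEquiv φ.symm.toLinearEquiv

variable [F.functor.CommShift ℤ] [F.functor.IsTriangulated]

theorem hom_twists_eq_zero_of_isExceptional (hnabla : IsExceptional E F nabla) {i j : I × ℤ}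
    {n : ℤ} (hij : i.1 ≤ j.1) (hne : ¬(i = j ∧ n = 0))
    (f : twists F nabla i ⟶ (twists F nabla j)⟦n⟧) : f = 0 := by
  obtain ⟨i, k⟩ := i
  obtain ⟨j, l⟩ := j
  obtain hij | rfl := hij.lt_or_eq
  · exact twist_hom_eq_zero F (hnabla.hom_eq_zero i j hij n (l - k)) f
  · refine twist_hom_eq_zero F (hnabla.self_hom_eq_zero i n (l - k) ?_) f
    rintro ⟨rfl, hkl⟩
    obtain rfl : l = k := sub_eq_zero.1 hkl
    exact hne ⟨rfl, rfl⟩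

theorem ofLevel_twists_le_rightOrthogonal_of_isExceptional (hnabla : IsExceptional E F nabla)
    (e : I ↪o ℕ) (m : ℕ) :
    ofLevel (twistLevel e) (twists F nabla) m ≤
      (belowLevel (twistLevel e) (twists F nabla) m).rightOrthogonal := by
  rintro _ ⟨j, rfl, rfl⟩
  refine rightOrthogonal_triClosure ?_
  rintro _ ⟨i, hij, rfl⟩ n f
  exact hom_twists_eq_zero_of_isExceptional hnabla (e.lt_iff_lt.1 hij).le
    (fun h => hij.ne (congrArg (twistLevel e) h.1)) f

theorem exists_comparison_twists [IsTriangulated C] (hnabla : IsExceptional E F nabla)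
    (hdelta : IsDual F nabla delta) (e : I ↪o ℕ) (j : I × ℤ) :
    ∃ c : twists F delta j ⟶ twists F nabla j,
      (belowLevel (twistLevel e) (twists F nabla) (twistLevel e j)).trW c := by
  obtain ⟨c, Z, g, h, hT, hZ⟩ := exists_comparison F hdelta e
    (ofLevel_twists_le_rightOrthogonal_of_isExceptional hnabla e) j.1
  obtain ⟨h', hT'⟩ := twist_distTriang F j.2 hT
  exact ⟨_, _, _, h', hT', belowLevel_twist F e nabla j.2 hZ⟩

theorem isDualPair_twists [IsTriangulated C] [IsDomain E] [PreValuationRing E]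
    (hnabla : IsExceptional E F nabla) (hdelta : IsDual F nabla delta) (e : I ↪o ℕ) :
    IsDualPair (twistLevel e) (twists F nabla) (twists F delta) where
  hom_eq_zero i j n f hij hne :=
    hom_twists_eq_zero_of_isExceptional hnabla (e.le_iff_le.1 hij) hne f
  dual_hom_eq_zero i j n f hij :=
    twist_hom_eq_zero F (hdelta.hom_eq_zero i.1 j.1 (e.lt_iff_lt.1 hij) n (i.2 - j.2)) f
  generates X := exists_belowLevel_of_generated F e nabla (hnabla.generates X)
  exists_comparison := exists_comparison_twists hnabla hdelta e
  comp_eq_zero j p q h := by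
    obtain ⟨p, rfl⟩ := (F ^ j.2).functor.map_surjective p
    obtain ⟨q, rfl⟩ := (F ^ j.2).functor.map_surjective q
    rw [← Functor.map_comp, Functor.map_eq_zero_iff] at h
    simpa only [Functor.map_eq_zero_iff] using eq_zero_or_eq_zero_of_end_comp_eq_zero
      (bijective_algebraMap_end_of_isExceptional hnabla j.1) h
  factor j p q := by
    obtain ⟨p, rfl⟩ := (F ^ j.2).functor.map_surjective p
    obtain ⟨q, rfl⟩ := (F ^ j.2).functor.map_surjective q
    obtain ⟨v, rfl⟩ | ⟨v, rfl⟩ := exists_end_comp_eq_or_exists_end_comp_eq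
      (bijective_algebraMap_end_of_isExceptional hnabla j.1) p q
    · exact Or.inl ⟨_, (F ^ j.2).functor.map_comp v q⟩
    · exact Or.inr ⟨_, (F ^ j.2).functor.map_comp v p⟩

end ExceptionalSequence

end ExcSeq

theorem mainTheorem8_general
    {E : Type w} [CommRing E] [IsDomain E] [IsPrincipalIdealRing E] [IsLocalRing E]
    (ϖ : E) (hϖ : IsLocalRing.maximalIdeal E = Ideal.span {ϖ})
    {C : Type u} [Category.{v} C] [Preadditive C] [HasZeroObject C] [HasShift C ℤ]
    [∀ n : ℤ, (shiftFunctor C n).Additive] [Pretriangulated C] [IsTriangulated C] [Linear E C]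
    (F : C ≌ C) [F.functor.CommShift ℤ] [F.functor.IsTriangulated]
    (hfin : ExcSeq.GradedHomFinite E F)
    {I : Type w'} [LinearOrder I] (nabla delta : I → C)
    (hnabla : ExcSeq.IsExceptional E F nabla) (hdelta : ExcSeq.IsDual F nabla delta) :
    ∃ t : Triangulated.TStructure C,
      t.le 0 = ExcSeq.tLE F delta ∧
      t.ge 0 = ExcSeq.tGE ϖ F nabla ∧
      Nonempty (Abelian t.heart.FullSubcategory) ∧
      (∀ X : t.heart.FullSubcategory, IsNoetherianObject X) ∧
      (IsField E → ∀ X : t.heart.FullSubcategory, IsArtinianObject X) := by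
  obtain ⟨e⟩ := hnabla.index
  have hend := ExcSeq.bijective_algebraMap_end_of_isExceptional hnabla
  have hp := ExcSeq.isDualPair_twists hnabla hdelta e
  exact ⟨hp.tStructure, ExcSeq.dualLE_twists_eq_tLE F delta,
    ExcSeq.excGE_twists_eq_tGE F fun i => ExcSeq.extClosure_endCone_eq hϖ (hend i),
    ⟨ExcSeq.heartAbelian _⟩,
    hp.isNoetherianObject (ExcSeq.homKernelsStabilize_ofLevel_twists hfin e.injective delta),
    fun hE => hp.isArtinianObject
      (fun j _ hB => ExcSeq.isZero_of_endCone_twist F j.2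
        (fun _ h => ExcSeq.isIso_of_ne_zero_of_isField (hend j.1) hE h) hB)
      (ExcSeq.homKernelsStabilize_op_ofLevel_twists hfin e.injective nabla)⟩

theorem mainTheorem8
    {E : Type w} [CommRing E] [IsDomain E] [IsPrincipalIdealRing E] [IsLocalRing E]
    [IsAdicComplete (IsLocalRing.maximalIdeal E) E]
    (ϖ : E) (hϖ : IsLocalRing.maximalIdeal E = Ideal.span {ϖ})
    {C : Type u} [Category.{v} C] [Preadditive C] [HasZeroObject C] [HasShift C ℤ]
    [∀ n : ℤ, (shiftFunctor C n).Additive] [Pretriangulated C] [IsTriangulated C]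
    [Linear E C] [∀ n : ℤ, (shiftFunctor C n).Linear E]
    (F : C ≌ C) [F.functor.CommShift ℤ] [F.functor.IsTriangulated]
    (hfin : ExcSeq.GradedHomFinite E F)
    {I : Type w'} [LinearOrder I] (nabla delta : I → C)
    (hnabla : ExcSeq.IsExceptional E F nabla) (hdelta : ExcSeq.IsDual F nabla delta) :
    ∃ t : Triangulated.TStructure C,
      t.le 0 = ExcSeq.tLE F delta ∧
      t.ge 0 = ExcSeq.tGE ϖ F nabla ∧
      Nonempty (Abelian t.heart.FullSubcategory) ∧
      (∀ X : t.heart.FullSubcategory, IsNoetherianObject X) ∧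
      (IsField E → ∀ X : t.heart.FullSubcategory, IsArtinianObject X) :=
  mainTheorem8_general ϖ hϖ F hfin nabla delta hnabla hdelta
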